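/- Let $F_{14}$ be the cubic graph with vertices $A,A',B,B',1,\dots,8$ and edges $AA'$, $BB'$, $A1$, $A5$, $A'3$, $A'7$, $B2$, $B6$, $B'4$, $B'8$, $12$, $23$, $34$, $45$, $56$, $67$, $78$, $81$. For a graph $G$, a graph $G\cup e$ is obtained from $G$ in one of three ways (loops and parallel edges are allowed in the result): - subdivide an edge of $G$ once by a new vertex $u$, and add a new vertex $v$, an edge $uv$ and a loop at $v$; - subdivide an edge of $G$ twice by new vertices $u,v$, and add a further edge $uv$; - subdivide two distinct edges $e_1,e_2$ of $G$ once each, by new vertices $u$ and $v$ respectively, and add the edge $uv$; this choice is denoted $e_1-e_2$. An embedding of a graph into a surface maps vertices to distinct points and edges to curves joining the images of their ends, such that the curves are simple and contain images of vertices only at their ends, and distinct curves meet only in images of vertices (the curve of a loop is a simple closed curve). A graph is toroidal if it embeds into the torus $T^2$. A face of an embedding is a connected component of the complement of its image. Then: 1. For every choice of $e$, the graph $F_{14}\cup e$ is toroidal. 2. Up to automorphisms of $F_{14}$ there are at most twelve choices of $e$ for which $F_{14}\cup e$ has girth at least four: every such choice is carried by an automorphism of $F_{14}$ to one of $AA'-BB'$,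 $AA'-B2$, $AA'-12$, $A1-A'3$, $A1-B2$, $A1-B6$, $A1-23$, $A1-34$, $A1-45$, $12-34$, $12-45$, $12-56$. 3. There is an embedding $\varphi$ of $F_{14}$ into $T^2$ with a face whose boundary is (the image of) an 8-cycle of $F_{14}$, such that for each of the twelve choices $e_1-e_2$ in part 2 there is an automorphism $\sigma$ of $F_{14}$ for which $\varphi$ extends to an embedding of $F_{14}\cup e$ with $e=\sigma(e_1)-\sigma(e_2)$ into $T^2$ (that is, the vertices of $F_{14}$ keep their images, and the image of each subdivided edge is the union of the images of its two halves). -/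

import Mathlib

namespace Graph

variable {α β : Type*}

/-- A cycle of length `n` in a multigraph: `n` distinct vertices and `n` distinct edges in cyclic
order. A loop is a cycle of length one, two parallel edges form a cycle of length two. -/
structure IsCycleOn (G : Graph α β) (n : ℕ) (v : ZMod n → α) (e : ZMod n → β) : Prop where
  pos : 0 < n
  vertex_injective : Function.Injective v
  edge_injective : Function.Injective e
  isLink : ∀ i, G.IsLink (e i) (v i) (v (i + 1))

/-- The girth: the length of a shortest cycle (`⊤` if there is no cycle). -/
noncomputable def girth (G : Graph α β) : ℕ∞ :=
  sInf {N : ℕ∞ | ∃ (n : ℕ) (v : ZMod n → α) (e : ZMod n → β), G.IsCycleOn n v e ∧ N = n}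

/-- An embedding of a multigraph into a topological space: vertices are distinct points, an edge is
a curve joining the images of its ends, the interior of this curve is simple, contains no vertex,
and is disjoint from the interior of the curve of any other edge. -/
structure SpaceEmbedding (G : Graph α β) (X : Type*) [TopologicalSpace X] where
  vert : α → X
  arc : β → C(unitInterval, X)
  vert_injOn : Set.InjOn vert G.vertexSet
  arc_ends : ∀ e ∈ G.edgeSet, ∃ x y, G.IsLink e x y ∧ arc e 0 = vert x ∧ arc e 1 = vert y
  arc_injOn : ∀ e ∈ G.edgeSet, Set.InjOn (arc e) (Set.Ioo 0 1)
  arc_ne_vert : ∀ e ∈ G.edgeSet, ∀ t ∈ Set.Ioo (0 : unitInterval) 1, ∀ x ∈ G.vertexSet,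
    arc e t ≠ vert x
  arc_disjoint : ∀ e ∈ G.edgeSet, ∀ f ∈ G.edgeSet, e ≠ f →
    ∀ s ∈ Set.Ioo (0 : unitInterval) 1, ∀ t ∈ Set.Ioo (0 : unitInterval) 1, arc e s ≠ arc f t

/-- The image of an embedded graph. -/
def SpaceEmbedding.image {G : Graph α β} {X : Type*} [TopologicalSpace X]
    (φ : G.SpaceEmbedding X) : Set X :=
  φ.vert '' G.vertexSet ∪ ⋃ e ∈ G.edgeSet, Set.range (φ.arc e)

/-- A face: a connected component of the complement of the image. -/
def SpaceEmbedding.IsFace {G : Graph α β} {X : Type*} [TopologicalSpace X]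
    (φ : G.SpaceEmbedding X) (U : Set X) : Prop :=
  ∃ p ∈ φ.imageᶜ, U = connectedComponentIn φ.imageᶜ p

/-- Some face of the embedding is bounded by a cycle of length `n`. -/
def SpaceEmbedding.HasFacialCycle {G : Graph α β} {X : Type*} [TopologicalSpace X]
    (φ : G.SpaceEmbedding X) (n : ℕ) : Prop :=
  ∃ (U : Set X) (v : ZMod n → α) (e : ZMod n → β), φ.IsFace U ∧ G.IsCycleOn n v e ∧
    frontier U = ⋃ i, Set.range (φ.arc (e i))

/-- A graph is toroidal if it embeds into the torus `(ℝ / ℤ)²`. -/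
def IsToroidal (G : Graph α β) : Prop :=
  Nonempty (G.SpaceEmbedding (UnitAddTorus (Fin 2)))

/-- The three ways of attaching an edge to `G`. The vertices `u`, `v` are new.
* `lollipop`: subdivide the edge `e = xy` by `u`, add the vertex `v`, an edge `uv` and a loop `vv`;
* `parallel`: subdivide the edge `e = xy` twice, to `x u v y`, and add a second edge `uv`;
* `join`: subdivide distinct edges `e₁ = x₁y₁` by `u` and `e₂ = x₂y₂` by `v`, add an edge `uv`. -/
inductive EdgeAddition (G : Graph α β) where
  | lollipop (e : β) (x y : α) (h : G.IsLink e x y)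
  | parallel (e : β) (x y : α) (h : G.IsLink e x y)
  | join (e₁ : β) (x₁ y₁ : α) (h₁ : G.IsLink e₁ x₁ y₁)
      (e₂ : β) (x₂ y₂ : α) (h₂ : G.IsLink e₂ x₂ y₂) (hne : e₁ ≠ e₂)

namespace EdgeAddition

variable {G : Graph α β}

/-- The edges of `G` that are subdivided. -/
def subdivided : G.EdgeAddition → Set β
  | lollipop e _ _ _ => {e}
  | parallel e _ _ _ => {e}
  | join e₁ _ _ _ e₂ _ _ _ _ => {e₁, e₂}

/-- The ends of the edges that are not edges of `G`; `u` is `Sum.inr 0` and `v` is `Sum.inr 1`. -/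
def newEnds : G.EdgeAddition → List (Sym2 (α ⊕ Fin 2))
  | lollipop _ x y _ =>
      [s(.inl x, .inr 0), s(.inr 0, .inl y), s(.inr 0, .inr 1), s(.inr 1, .inr 1)]
  | parallel _ x y _ =>
      [s(.inl x, .inr 0), s(.inr 0, .inr 1), s(.inr 1, .inl y), s(.inr 0, .inr 1)]
  | join _ x₁ y₁ _ _ x₂ y₂ _ _ =>
      [s(.inl x₁, .inr 0), s(.inr 0, .inl y₁), s(.inl x₂, .inr 1), s(.inr 1, .inl y₂),
        s(.inr 0, .inr 1)]

/-- The incidence relation of `G ∪ e`: the edges of `G` that are not subdivided, and one edge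
`Sum.inr i` for each entry of `newEnds`, in position `i`. -/
def Link (c : G.EdgeAddition) : β ⊕ ℕ → α ⊕ Fin 2 → α ⊕ Fin 2 → Prop
  | .inl f, a, b => f ∉ c.subdivided ∧ ∃ x y, G.IsLink f x y ∧ a = .inl x ∧ b = .inl y
  | .inr i, a, b => c.newEnds[i]? = some s(a, b)

theorem mem_of_newEnds (c : G.EdgeAddition) {i : ℕ} {a b : α ⊕ Fin 2}
    (h : c.newEnds[i]? = some s(a, b)) : Sum.elim (· ∈ G.vertexSet) (fun _ => True) a := by
  have h' : s(a, b) ∈ c.newEnds := List.mem_of_getElem? h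
  cases c with
  | lollipop e x y hl =>
    have := hl.left_mem
    have := hl.right_mem
    simp only [newEnds, List.mem_cons, List.not_mem_nil, Sym2.eq_iff] at h'
    rcases a with a | a <;> simp_all
    aesop
  | parallel e x y hl =>
    have := hl.left_mem
    have := hl.right_mem
    simp only [newEnds, List.mem_cons, List.not_mem_nil, Sym2.eq_iff] at h'
    rcases a with a | a <;> simp_all
    aesop
  | join e₁ x₁ y₁ hl e₂ x₂ y₂ hl' hne =>
    have := hl.left_mem
    have := hl.right_mem
    have := hl'.left_mem
    have := hl'.right_mem
    simp only [newEnds, List.mem_cons, List.not_mem_nil, Sym2.eq_iff] at h'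
    rcases a with a | a <;> simp_all
    aesop

/-- `f` is one of the edges of `G ∪ e` into which the edge `g` of `G` is cut. -/
def IsPiece : G.EdgeAddition → β ⊕ ℕ → β → Prop
  | _, .inl f, g => f = g
  | lollipop e _ _ _, .inr i, g => g = e ∧ (i = 0 ∨ i = 1)
  | parallel e _ _ _, .inr i, g => g = e ∧ (i = 0 ∨ i = 1 ∨ i = 2)
  | join e₁ _ _ _ e₂ _ _ _ _, .inr i, g =>
      (g = e₁ ∧ (i = 0 ∨ i = 1)) ∨ (g = e₂ ∧ (i = 2 ∨ i = 3))

/-- The new edge joins subdivision points of the two distinct edges `f` and `g` of `G`. -/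
def Joins : G.EdgeAddition → β → β → Prop
  | join e₁ _ _ _ e₂ _ _ _ _, f, g => (e₁ = f ∧ e₂ = g) ∨ (e₁ = g ∧ e₂ = f)
  | _, _, _ => False

end EdgeAddition

/-- The multigraph `G ∪ e` for a choice of `e`. -/
def addEdge (G : Graph α β) (c : G.EdgeAddition) : Graph (α ⊕ Fin 2) (β ⊕ ℕ) where
  vertexSet := Sum.inl '' G.vertexSet ∪ Set.range Sum.inr
  IsLink := c.Link
  isLink_symm := by
    rintro (f | i) - <;> refine ⟨fun a b h => ?_⟩
    · obtain ⟨hf, x, y, h, rfl, rfl⟩ := h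
      exact ⟨hf, y, x, h.symm, rfl, rfl⟩
    · simpa only [EdgeAddition.Link, Sym2.eq_swap] using h
  eq_or_eq_of_isLink_of_isLink := by
    rintro (f | i) a b a' b' h h'
    · obtain ⟨-, x, y, h, rfl, rfl⟩ := h
      obtain ⟨-, x', y', h', rfl, rfl⟩ := h'
      simpa using h.left_eq_or_eq h'
    · have := h.symm.trans h'
      simp only [Option.some.injEq, Sym2.eq_iff] at this
      tauto
  left_mem_of_isLink := by
    rintro (f | i) a b h
    · obtain ⟨-, x, y, h, rfl, rfl⟩ := h
      exact .inl ⟨x, h.left_mem, rfl⟩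
    · have := c.mem_of_newEnds h
      rcases a with a | a
      · exact .inl ⟨a, this, rfl⟩
      · exact .inr ⟨a, rfl⟩

/-- The embedding `ψ` of `G ∪ e` extends the embedding `φ` of `G`: the vertices of `G` keep their
place, and each edge of `G` is the union of the pieces into which it is cut. -/
def SpaceEmbedding.Extends {G : Graph α β} {X : Type*} [TopologicalSpace X] {c : G.EdgeAddition}
    (ψ : (G.addEdge c).SpaceEmbedding X) (φ : G.SpaceEmbedding X) : Prop :=
  (∀ x ∈ G.vertexSet, ψ.vert (.inl x) = φ.vert x) ∧
  ∀ g ∈ G.edgeSet, Set.range (φ.arc g) =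
    ⋃ f ∈ {f | f ∈ (G.addEdge c).edgeSet ∧ c.IsPiece f g}, Set.range (ψ.arc f)

end Graph

/-- The vertices `A, A', B, B', 1, …, 8` of `F₁₄` (`Ap`, `Bp` are the primed ones). -/
inductive F14Vertex
  | A | Ap | B | Bp | n1 | n2 | n3 | n4 | n5 | n6 | n7 | n8
  deriving DecidableEq

open F14Vertex in
/-- The cubic graph `F₁₄`: the 8-cycle `1 2 … 8` together with two trees, one with edges
`AA', A1, A5, A'3, A'7`, the other with edges `BB', B2, B6, B'4, B'8`. -/
def F14 : SimpleGraph F14Vertex :=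
  SimpleGraph.fromEdgeSet
    {s(A, Ap), s(B, Bp),
      s(A, n1), s(A, n5), s(Ap, n3), s(Ap, n7), s(B, n2), s(B, n6), s(Bp, n4), s(Bp, n8),
      s(n1, n2), s(n2, n3), s(n3, n4), s(n4, n5), s(n5, n6), s(n6, n7), s(n7, n8), s(n8, n1)}

/-- `F₁₄` as a multigraph. -/
def F14Graph : Graph F14Vertex (Sym2 F14Vertex) := Graph.ofSimpleGraph F14

open F14Vertex in
/-- Twelve pairs of edges of `F₁₄`. -/
def F14Cases : List (Sym2 F14Vertex × Sym2 F14Vertex) :=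
  [(s(A, Ap), s(B, Bp)), (s(A, Ap), s(B, n2)), (s(A, Ap), s(n1, n2)),
    (s(A, n1), s(Ap, n3)), (s(A, n1), s(B, n2)), (s(A, n1), s(B, n6)),
    (s(A, n1), s(n2, n3)), (s(A, n1), s(n3, n4)), (s(A, n1), s(n4, n5)),
    (s(n1, n2), s(n3, n4)), (s(n1, n2), s(n4, n5)), (s(n1, n2), s(n5, n6))]

/-! The torus is taken as the plane modulo `8ℤ²`, and `F₁₄` is drawn on it with straight edges
between lattice points (`F14.drawing`). Three faces of this drawing are used: an octagon and two
hexagons, each the injective image of an open convex lattice polygon. A new edge can be drawn inside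
such a face between any two of its sides, or between two points of one side, and a lollipop can be
attached to any side.

The rest is symmetry. The rotation and a reflection of the cycle `1 2 … 8` generate sixteen
automorphisms, and a finite check (`F14.exists_automorphism_sides`) shows that one of them carries
any two distinct edges to two sides of a common face among the three. Relabelling the drawing by
this automorphism gives toroidality of every `F₁₄ ∪ e`. If instead the drawing stays fixed and the
choice of `e` is moved, the result is the third part, since the octagon is bounded by an 8-cycle.

For the second part, a lollipop creates a loop, a parallel edge a digon, and a join of two edges
with a common end a triangle. Girth at least four therefore leaves joins of disjoint edges, and
`F14.exists_automorphism_mem_cases` checks that each such pair is equivalent to a listed one.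

The geometry is reduced to integer inequalities. Crossing-freeness and the shape of the faces are
certified by signs of signed areas for finitely many translates, because everything lies in a box of
side 16. From these certificates `connectedComponentIn_compl_image` and `frontier_gridTorus_image`
identify the face and its boundary, and `hasChord`, `hasChord_self` and `hasLollipop` supply the
curves. `exists_extends_join`, `nonempty_parallel` and `nonempty_lollipop` turn the curves into
embeddings of `G ∪ e`. -/

open Set

/-! ### Cutting and reversing arcs; assembling an embedding of `G ∪ e` -/

namespace Graph

variable {α β X : Type*} [TopologicalSpace X] {G : Graph α β}

/-- The affine reparametrization of the unit interval onto `[s, t]`. -/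
def unitReparam (s t : unitInterval) : C(unitInterval, unitInterval) where
  toFun r := ⟨(1 - r) * s + r * t, by
    obtain ⟨⟨r0, r1⟩, ⟨s0, s1⟩, ⟨t0, t1⟩⟩ := And.intro r.2 (And.intro s.2 t.2)
    constructor <;> nlinarith⟩
  continuous_toFun := by fun_prop

theorem unitReparam_zero (s t : unitInterval) : unitReparam s t 0 = s := by
  ext; simp [unitReparam]

theorem unitReparam_one (s t : unitInterval) : unitReparam s t 1 = t := by
  ext; simp [unitReparam]

theorem unitReparam_strictMono {s t : unitInterval} (h : s < t) :
    StrictMono (unitReparam s t) := by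
  intro a b hab
  have h' : (s : ℝ) < t := h
  have hab' : (a : ℝ) < b := hab
  change (1 - (a : ℝ)) * s + a * t < (1 - (b : ℝ)) * s + b * t
  nlinarith

theorem unitReparam_image_Ioo {s t : unitInterval} (h : s < t) :
    unitReparam s t '' Ioo 0 1 = Ioo s t := by
  have hm := unitReparam_strictMono h
  apply subset_antisymm
  · rintro _ ⟨r, hr, rfl⟩
    exact ⟨(unitReparam_zero s t).symm.trans_lt (hm hr.1),
      (hm hr.2).trans_eq (unitReparam_one s t)⟩
  · have := intermediate_value_Ioo (zero_le_one (α := unitInterval))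
      (unitReparam s t).continuous.continuousOn
    rwa [unitReparam_zero, unitReparam_one] at this

theorem unitReparam_range {s t : unitInterval} (h : s < t) :
    range (unitReparam s t) = Icc s t := by
  have hm := (unitReparam_strictMono h).monotone
  apply subset_antisymm
  · rintro _ ⟨r, rfl⟩
    exact ⟨(unitReparam_zero s t).symm.trans_le (hm r.2.1),
      (hm r.2.2).trans_eq (unitReparam_one s t)⟩
  · have := intermediate_value_Icc (zero_le_one (α := unitInterval))
      (unitReparam s t).continuous.continuousOn
    rw [unitReparam_zero, unitReparam_one] at this
    exact this.trans (image_subset_range _ _)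

theorem Ioo_subset_unit (s t : unitInterval) : Ioo s t ⊆ Ioo 0 1 :=
  fun _ hr => ⟨s.2.1.trans_lt hr.1, hr.2.trans_le t.2.2⟩

/-- The part of a curve between the parameters `s` and `t`. -/
def subarc (a : C(unitInterval, X)) (s t : unitInterval) : C(unitInterval, X) :=
  a.comp (unitReparam s t)

section subarc

variable (a : C(unitInterval, X)) {s t : unitInterval}

@[simp] theorem subarc_zero : subarc a s t 0 = a s := by
  simp [subarc, unitReparam_zero]

@[simp] theorem subarc_one : subarc a s t 1 = a t := by
  simp [subarc, unitReparam_one]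

theorem subarc_image_Ioo (h : s < t) : subarc a s t '' Ioo 0 1 = a '' Ioo s t := by
  rw [← unitReparam_image_Ioo h, ← image_comp]; rfl

theorem subarc_range (h : s < t) : range (subarc a s t) = a '' Icc s t := by
  rw [← unitReparam_range h, ← range_comp]; rfl

theorem subarc_injOn (ha : InjOn a (Ioo 0 1)) (h : s < t) :
    InjOn (subarc a s t) (Ioo 0 1) := by
  refine ha.comp (unitReparam_strictMono h).injective.injOn fun r hr => ?_
  exact Ioo_subset_unit s t (unitReparam_image_Ioo h ▸ mem_image_of_mem _ hr)

end subarc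

theorem exists_reverse (a : C(unitInterval, X)) :
    ∃ b : C(unitInterval, X), b 0 = a 1 ∧ b 1 = a 0 ∧ (InjOn a (Ioo 0 1) → InjOn b (Ioo 0 1)) ∧
      b '' Ioo 0 1 = a '' Ioo 0 1 ∧ range b = range a := by
  have hs : unitInterval.symm '' Ioo 0 1 = Ioo 0 1 := by
    have hm : MapsTo unitInterval.symm (Ioo 0 1) (Ioo 0 1) := fun t ht =>
      ⟨unitInterval.pos_iff_ne_zero.2 (by simpa using ht.2.ne),
        unitInterval.lt_one_iff_ne_one.2 (by simpa using ht.1.ne')⟩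
    exact subset_antisymm hm.image_subset fun t ht => ⟨_, hm ht, unitInterval.symm_symm t⟩
  refine ⟨a.comp ⟨unitInterval.symm, by fun_prop⟩, by simp, by simp, fun ha => ?_, ?_, ?_⟩
  · refine ha.comp unitInterval.symm_bijective.injective.injOn fun r hr => ?_
    exact hs ▸ mem_image_of_mem _ hr
  · conv_rhs => rw [← hs, ← image_comp]
    rfl
  · exact unitInterval.symm_bijective.surjective.range_comp _

namespace SpaceEmbedding

variable (φ : G.SpaceEmbedding X)

/-- An embedded edge can be traversed in either direction. -/
theorem exists_oriented_arc {e : β} {x y : α} (h : G.IsLink e x y) :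
    ∃ a : C(unitInterval, X), a 0 = φ.vert x ∧ a 1 = φ.vert y ∧ InjOn a (Ioo 0 1) ∧
      a '' Ioo 0 1 = φ.arc e '' Ioo 0 1 ∧ range a = range (φ.arc e) := by
  obtain ⟨x', y', h', h0, h1⟩ := φ.arc_ends e h.edge_mem
  have inj := φ.arc_injOn e h.edge_mem
  obtain ⟨rfl, rfl⟩ | ⟨rfl, rfl⟩ := h.eq_and_eq_or_eq_and_eq h'
  · exact ⟨_, h0, h1, inj, rfl, rfl⟩
  · obtain ⟨b, b0, b1, bi, bI, br⟩ := exists_reverse (φ.arc e)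
    exact ⟨b, b0.trans h1, b1.trans h0, bi inj, bI, br⟩

theorem vert_notMem_image_Ioo {e : β} (he : e ∈ G.edgeSet) {x : α} (hx : x ∈ G.vertexSet) :
    φ.vert x ∉ φ.arc e '' Ioo 0 1 := by
  rintro ⟨t, ht, h⟩
  exact φ.arc_ne_vert e he t ht x hx h

theorem disjoint_image_Ioo {e f : β} (he : e ∈ G.edgeSet) (hf : f ∈ G.edgeSet) (h : e ≠ f) :
    Disjoint (φ.arc e '' Ioo 0 1) (φ.arc f '' Ioo 0 1) := by
  rw [disjoint_left]
  rintro _ ⟨s, hs, rfl⟩ ⟨t, ht, h'⟩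
  exact φ.arc_disjoint e he f hf h s hs t ht h'.symm

theorem vert_mem_image {x : α} (hx : x ∈ G.vertexSet) : φ.vert x ∈ φ.image :=
  .inl (mem_image_of_mem _ hx)

theorem image_Ioo_subset_image {e : β} (he : e ∈ G.edgeSet) : φ.arc e '' Ioo 0 1 ⊆ φ.image :=
  fun _ hz => .inr (mem_biUnion he (image_subset_range _ _ hz))

end SpaceEmbedding

theorem inl_mem_addEdge_edgeSet {c : G.EdgeAddition} {f : β} :
    .inl f ∈ (G.addEdge c).edgeSet ↔ f ∈ G.edgeSet ∧ f ∉ c.subdivided := by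
  rw [Graph.edge_mem_iff_exists_isLink, Graph.edge_mem_iff_exists_isLink]
  constructor
  · rintro ⟨_, _, hf, x, y, h, -, -⟩
    exact ⟨⟨x, y, h⟩, hf⟩
  · rintro ⟨⟨x, y, h⟩, hf⟩
    exact ⟨_, _, hf, x, y, h, rfl, rfl⟩

theorem inr_mem_addEdge_edgeSet {c : G.EdgeAddition} {i : ℕ} :
    .inr i ∈ (G.addEdge c).edgeSet ↔ i < c.newEnds.length := by
  rw [Graph.edge_mem_iff_exists_isLink]
  constructor
  · rintro ⟨a, b, h⟩
    exact (List.getElem?_eq_some_iff.1 h).1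
  · intro h
    obtain ⟨⟨a, b⟩, hab⟩ := Quot.exists_rep c.newEnds[i]
    exact ⟨a, b, List.getElem?_eq_some_iff.2 ⟨h, hab.symm⟩⟩

/-- The embedding of `G ∪ e` that keeps `φ` on the edges that are not subdivided. -/
def SpaceEmbedding.addEdge (φ : G.SpaceEmbedding X) (c : G.EdgeAddition) (p : Fin 2 → X)
    (a : ℕ → C(unitInterval, X)) (hp : Function.Injective p)
    (hpv : ∀ i, ∀ x ∈ G.vertexSet, φ.vert x ≠ p i)
    (hpa : ∀ i, ∀ f ∈ G.edgeSet, f ∉ c.subdivided → p i ∉ φ.arc f '' Ioo 0 1)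
    (ends : ∀ i e, c.newEnds[i]? = some e → ∃ x y, e = s(x, y) ∧
      a i 0 = Sum.elim φ.vert p x ∧ a i 1 = Sum.elim φ.vert p y)
    (inj : ∀ i < c.newEnds.length, InjOn (a i) (Ioo 0 1))
    (hav : ∀ i < c.newEnds.length, ∀ x ∈ G.vertexSet, φ.vert x ∉ a i '' Ioo 0 1)
    (hap : ∀ i < c.newEnds.length, ∀ j, p j ∉ a i '' Ioo 0 1)
    (haa : ∀ i < c.newEnds.length, ∀ f ∈ G.edgeSet, f ∉ c.subdivided →
      Disjoint (a i '' Ioo 0 1) (φ.arc f '' Ioo 0 1))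
    (hdisj : ∀ j < c.newEnds.length, ∀ i < j, Disjoint (a i '' Ioo 0 1) (a j '' Ioo 0 1)) :
    (G.addEdge c).SpaceEmbedding X where
  vert := Sum.elim φ.vert p
  arc := Sum.elim φ.arc a
  vert_injOn := by
    rintro (x | i) hx (y | j) hy h
    · have hx' : x ∈ G.vertexSet := by simpa [Graph.addEdge] using hx
      have hy' : y ∈ G.vertexSet := by simpa [Graph.addEdge] using hy
      exact congrArg _ (φ.vert_injOn hx' hy' h)
    · exact (hpv j x (by simpa [Graph.addEdge] using hx) h).elim
    · exact (hpv i y (by simpa [Graph.addEdge] using hy) h.symm).elim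
    · exact congrArg _ (hp h)
  arc_ends := by
    rintro (f | i) hf
    · obtain ⟨hf, hfs⟩ := inl_mem_addEdge_edgeSet.1 hf
      obtain ⟨x, y, h, h0, h1⟩ := φ.arc_ends f hf
      exact ⟨.inl x, .inl y, ⟨hfs, x, y, h, rfl, rfl⟩, h0, h1⟩
    · have hi := inr_mem_addEdge_edgeSet.1 hf
      obtain ⟨x, y, h, h0, h1⟩ := ends i _ (List.getElem?_eq_getElem hi)
      exact ⟨x, y, (List.getElem?_eq_getElem hi).trans (congrArg _ h), h0, h1⟩
  arc_injOn := by
    rintro (f | i) hf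
    · exact φ.arc_injOn f (inl_mem_addEdge_edgeSet.1 hf).1
    · exact inj i (inr_mem_addEdge_edgeSet.1 hf)
  arc_ne_vert := by
    rintro (f | i) hf t ht (x | j) hx h
    · exact φ.arc_ne_vert f (inl_mem_addEdge_edgeSet.1 hf).1 t ht x
        (by simpa [Graph.addEdge] using hx) h
    · exact hpa j f (inl_mem_addEdge_edgeSet.1 hf).1 (inl_mem_addEdge_edgeSet.1 hf).2 ⟨t, ht, h⟩
    · exact hav i (inr_mem_addEdge_edgeSet.1 hf) x (by simpa [Graph.addEdge] using hx) ⟨t, ht, h⟩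
    · exact hap i (inr_mem_addEdge_edgeSet.1 hf) j ⟨t, ht, h⟩
  arc_disjoint := by
    rintro (e | i) he (f | j) hf hne s hs t ht h
    · exact φ.arc_disjoint e (inl_mem_addEdge_edgeSet.1 he).1 f (inl_mem_addEdge_edgeSet.1 hf).1
        (by simpa using hne) s hs t ht h
    · obtain ⟨he, hes⟩ := inl_mem_addEdge_edgeSet.1 he
      exact disjoint_left.1 (haa j (inr_mem_addEdge_edgeSet.1 hf) e he hes) ⟨t, ht, h.symm⟩
        ⟨s, hs, rfl⟩
    · obtain ⟨hf, hfs⟩ := inl_mem_addEdge_edgeSet.1 hf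
      exact disjoint_left.1 (haa i (inr_mem_addEdge_edgeSet.1 he) f hf hfs) ⟨s, hs, h⟩
        ⟨t, ht, rfl⟩
    · have hij : i ≠ j := by simpa using hne
      rcases hij.lt_or_gt with hij | hij
      · exact disjoint_left.1 (hdisj j (inr_mem_addEdge_edgeSet.1 hf) i hij) ⟨s, hs, rfl⟩
          ⟨t, ht, h.symm⟩
      · exact disjoint_left.1 (hdisj i (inr_mem_addEdge_edgeSet.1 he) j hij) ⟨t, ht, rfl⟩
          ⟨s, hs, h⟩

end Graph

/-! ### Extending an embedding along a chord or a lollipop in a face -/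

namespace Graph

variable {α β X : Type*} [TopologicalSpace X] {G : Graph α β}

theorem subarc_image_subset (a : C(unitInterval, X)) {s t : unitInterval} (h : s < t) :
    subarc a s t '' Ioo 0 1 ⊆ a '' Ioo 0 1 := by
  rw [subarc_image_Ioo a h]
  exact image_mono (Ioo_subset_unit s t)

theorem notMem_subarc_image {a : C(unitInterval, X)} (ha : InjOn a (Ioo 0 1))
    {r s t : unitInterval} (hr : r ∈ Ioo 0 1) (h : s < t) (hn : r ∉ Ioo s t) :
    a r ∉ subarc a s t '' Ioo 0 1 := by
  rw [subarc_image_Ioo a h]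
  rintro ⟨q, hq, h'⟩
  exact hn (ha (Ioo_subset_unit s t hq) hr h' ▸ hq)

theorem disjoint_subarc_image {a : C(unitInterval, X)} (ha : InjOn a (Ioo 0 1))
    {s t s' t' : unitInterval} (h : s < t) (h' : s' < t') (hle : t ≤ s') :
    Disjoint (subarc a s t '' Ioo 0 1) (subarc a s' t' '' Ioo 0 1) := by
  rw [subarc_image_Ioo a h, subarc_image_Ioo a h', disjoint_left]
  rintro _ ⟨q, hq, rfl⟩ ⟨r, hr, he⟩
  have := ha (Ioo_subset_unit s' t' hr) (Ioo_subset_unit s t hq) he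
  exact ((hq.2.trans_le hle).trans hr.1).ne this.symm

namespace SpaceEmbedding

variable (φ : G.SpaceEmbedding X)

/-- A curve through a face of `φ` that joins interior points of the edges `e` and `f`. -/
def HasChord (e f : β) : Prop :=
  ∃ p ∈ φ.arc e '' Ioo 0 1, ∃ q ∈ φ.arc f '' Ioo 0 1, p ≠ q ∧
    ∃ γ : C(unitInterval, X), γ 0 = p ∧ γ 1 = q ∧ InjOn γ (Ioo 0 1) ∧ γ '' Ioo 0 1 ⊆ φ.imageᶜ

/-- A curve through a face of `φ` from an interior point of the edge `e` to a point of the face,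
together with a loop at that point. -/
def HasLollipop (e : β) : Prop :=
  ∃ p ∈ φ.arc e '' Ioo 0 1, ∃ q ∈ φ.imageᶜ, ∃ γ l : C(unitInterval, X),
    γ 0 = p ∧ γ 1 = q ∧ l 0 = q ∧ l 1 = q ∧ InjOn γ (Ioo 0 1) ∧ InjOn l (Ioo 0 1) ∧
    γ '' Ioo 0 1 ⊆ φ.imageᶜ ∧ l '' Ioo 0 1 ⊆ φ.imageᶜ ∧ q ∉ γ '' Ioo 0 1 ∧ q ∉ l '' Ioo 0 1 ∧
    Disjoint (γ '' Ioo 0 1) (l '' Ioo 0 1)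

variable {φ}

theorem disjoint_compl_image {e : β} (he : e ∈ G.edgeSet) :
    Disjoint φ.imageᶜ (φ.arc e '' Ioo 0 1) :=
  disjoint_compl_left.mono_right (φ.image_Ioo_subset_image he)

/-- An embedding extends along a chord between two edges. -/
theorem exists_extends_join {e₁ e₂ : β} (h : φ.HasChord e₁ e₂) {x₁ y₁ x₂ y₂ : α}
    (h₁ : G.IsLink e₁ x₁ y₁) (h₂ : G.IsLink e₂ x₂ y₂) (hne : e₁ ≠ e₂) :
    ∃ ψ : (G.addEdge (.join e₁ x₁ y₁ h₁ e₂ x₂ y₂ h₂ hne)).SpaceEmbedding X, ψ.Extends φ := by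
  obtain ⟨p, hp, q, hq, hpq, γ, hγ0, hγ1, hγi, hγ⟩ := h
  have m₁ := h₁.edge_mem
  have m₂ := h₂.edge_mem
  have hd := φ.disjoint_image_Ioo m₁ m₂ hne
  have c₁ := disjoint_compl_image (φ := φ) m₁
  have c₂ := disjoint_compl_image (φ := φ) m₂
  obtain ⟨a, a0, a1, ai, aI, ar⟩ := φ.exists_oriented_arc h₁
  obtain ⟨b, b0, b1, bi, bI, br⟩ := φ.exists_oriented_arc h₂
  obtain ⟨s, hs, rfl⟩ := aI ▸ hp
  obtain ⟨t, ht, rfl⟩ := bI ▸ hq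
  rw [← aI] at hp hd c₁
  rw [← bI] at hq hd c₂
  let A : ℕ → C(unitInterval, X) := fun
    | 0 => subarc a 0 s
    | 1 => subarc a s 1
    | 2 => subarc b 0 t
    | 3 => subarc b t 1
    | _ => γ
  have l0 : A 0 '' Ioo 0 1 ⊆ a '' Ioo 0 1 := subarc_image_subset a hs.1
  have l1 : A 1 '' Ioo 0 1 ⊆ a '' Ioo 0 1 := subarc_image_subset a hs.2
  have l2 : A 2 '' Ioo 0 1 ⊆ b '' Ioo 0 1 := subarc_image_subset b ht.1
  have l3 : A 3 '' Ioo 0 1 ⊆ b '' Ioo 0 1 := subarc_image_subset b ht.2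
  have l4 : A 4 '' Ioo 0 1 ⊆ φ.imageᶜ := hγ
  -- The two open edges and the complement of the image are pairwise disjoint, so most disjointness
  -- conditions below only depend on which of these three sets contains an arc.
  have loc : ∀ i < 5, A i '' Ioo 0 1 ⊆ a '' Ioo 0 1 ∨ A i '' Ioo 0 1 ⊆ b '' Ioo 0 1 ∨
      A i '' Ioo 0 1 ⊆ φ.imageᶜ := by
    intro i hi
    interval_cases i <;> tauto
  refine ⟨φ.addEdge (.join e₁ x₁ y₁ h₁ e₂ x₂ y₂ h₂ hne) ![a s, b t] A ?_ ?_ ?_ ?_ ?_ ?_ ?_ ?_ ?_,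
    fun _ _ => rfl, ?_⟩
  · intro i j
    fin_cases i <;> fin_cases j <;> simp [hpq, hpq.symm]
  · intro i x hx hxi
    fin_cases i
    · exact φ.vert_notMem_image_Ioo m₁ hx (aI ▸ hxi ▸ hp)
    · exact φ.vert_notMem_image_Ioo m₂ hx (bI ▸ hxi ▸ hq)
  · intro i f hf hfs
    simp only [EdgeAddition.subdivided, mem_insert_iff, mem_singleton_iff, not_or] at hfs
    fin_cases i
    · exact disjoint_left.1 (φ.disjoint_image_Ioo m₁ hf (Ne.symm hfs.1)) (aI ▸ hp)
    · exact disjoint_left.1 (φ.disjoint_image_Ioo m₂ hf (Ne.symm hfs.2)) (bI ▸ hq)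
  · intro i e hi
    have hi' : i < 5 := (List.getElem?_eq_some_iff.1 hi).1
    interval_cases i <;> simp only [EdgeAddition.newEnds, List.getElem?_cons_zero,
      List.getElem?_cons_succ, Option.some.injEq] at hi <;> subst hi <;>
      exact ⟨_, _, rfl, by simp [A, *], by simp [A, *]⟩
  · intro i hi
    change i < 5 at hi
    interval_cases i
    exacts [subarc_injOn a ai hs.1, subarc_injOn a ai hs.2, subarc_injOn b bi ht.1,
      subarc_injOn b bi ht.2, hγi]
  · intro i hi x hx hxa
    rcases loc i hi with hl | hl | hl
    · exact φ.vert_notMem_image_Ioo m₁ hx (aI ▸ hl hxa)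
    · exact φ.vert_notMem_image_Ioo m₂ hx (bI ▸ hl hxa)
    · exact hl hxa (φ.vert_mem_image hx)
  · intro i hi j hj
    change i < 5 at hi
    have k1 := disjoint_left.1 hd hp
    have k2 := disjoint_right.1 hd hq
    have k3 := disjoint_right.1 c₁ hp
    have k4 := disjoint_right.1 c₂ hq
    fin_cases j <;> interval_cases i
    exacts [notMem_subarc_image ai hs hs.1 (by simp) hj,
      notMem_subarc_image ai hs hs.2 (by simp) hj,
      k1 (l2 hj), k1 (l3 hj), k3 (l4 hj), k2 (l0 hj), k2 (l1 hj),
      notMem_subarc_image bi ht ht.1 (by simp) hj, notMem_subarc_image bi ht ht.2 (by simp) hj,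
      k4 (l4 hj)]
  · intro i hi f hf hfs
    simp only [EdgeAddition.subdivided, mem_insert_iff, mem_singleton_iff, not_or] at hfs
    rcases loc i hi with hl | hl | hl
    · exact (φ.disjoint_image_Ioo m₁ hf (Ne.symm hfs.1)).mono_left (aI ▸ hl)
    · exact (φ.disjoint_image_Ioo m₂ hf (Ne.symm hfs.2)).mono_left (bI ▸ hl)
    · exact (disjoint_compl_image hf).mono_left hl
  · intro j hj i hij
    change j < 5 at hj
    interval_cases j <;> interval_cases i
    exacts [disjoint_subarc_image ai hs.1 hs.2 le_rfl, hd.mono l0 l2, hd.mono l1 l2,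
      hd.mono l0 l3, hd.mono l1 l3, disjoint_subarc_image bi ht.1 ht.2 le_rfl,
      (c₁.mono l4 l0).symm, (c₁.mono l4 l1).symm, (c₂.mono l4 l2).symm, (c₂.mono l4 l3).symm]
  · intro g hg
    have cut : ∀ (a : C(unitInterval, X)) {s} (hs : s ∈ Ioo 0 1),
        range a = range (subarc a 0 s) ∪ range (subarc a s 1) := by
      intro a s hs
      rw [subarc_range a hs.1, subarc_range a hs.2, ← image_union,
        Icc_union_Icc_eq_Icc hs.1.le hs.2.le, ← image_univ, unitInterval.univ_eq_Icc]
    have ha := cut a hs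
    have hb := cut b ht
    apply subset_antisymm
    · intro z hz
      rw [mem_iUnion₂]
      by_cases g1 : g = e₁
      · subst g1
        rw [← ar, ha] at hz
        rcases hz with hz | hz
        · exact ⟨.inr 0, ⟨inr_mem_addEdge_edgeSet.2 (by simp [EdgeAddition.newEnds]), by
            simp [EdgeAddition.IsPiece]⟩, hz⟩
        · exact ⟨.inr 1, ⟨inr_mem_addEdge_edgeSet.2 (by simp [EdgeAddition.newEnds]), by
            simp [EdgeAddition.IsPiece]⟩, hz⟩
      by_cases g2 : g = e₂
      · subst g2
        rw [← br, hb] at hz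
        rcases hz with hz | hz
        · exact ⟨.inr 2, ⟨inr_mem_addEdge_edgeSet.2 (by simp [EdgeAddition.newEnds]), by
            simp [EdgeAddition.IsPiece]⟩, hz⟩
        · exact ⟨.inr 3, ⟨inr_mem_addEdge_edgeSet.2 (by simp [EdgeAddition.newEnds]), by
            simp [EdgeAddition.IsPiece]⟩, hz⟩
      · exact ⟨.inl g, ⟨inl_mem_addEdge_edgeSet.2 ⟨hg, by
          simp [EdgeAddition.subdivided, g1, g2]⟩, rfl⟩, hz⟩
    · refine iUnion₂_subset ?_
      rintro (f | i) ⟨hf, hp⟩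
      · cases hp
        exact subset_rfl
      · rcases hp with ⟨rfl, rfl | rfl⟩ | ⟨rfl, rfl | rfl⟩
        · exact subset_union_left.trans_eq (ha.symm.trans ar)
        · exact subset_union_right.trans_eq (ha.symm.trans ar)
        · exact subset_union_left.trans_eq (hb.symm.trans br)
        · exact subset_union_right.trans_eq (hb.symm.trans br)

theorem nonempty_parallel {e : β} (h : φ.HasChord e e) {x y : α} (hl : G.IsLink e x y) :
    Nonempty ((G.addEdge (.parallel e x y hl)).SpaceEmbedding X) := by
  obtain ⟨a, a0, a1, ai, aI, -⟩ := φ.exists_oriented_arc hl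
  have m := hl.edge_mem
  have c := disjoint_compl_image (φ := φ) m
  rw [← aI] at c
  obtain ⟨s, hs, t, ht, hst, γ, hγ0, hγ1, hγi, hγ⟩ : ∃ s ∈ Ioo 0 1, ∃ t ∈ Ioo 0 1, s < t ∧
      ∃ γ : C(unitInterval, X), γ 0 = a s ∧ γ 1 = a t ∧ InjOn γ (Ioo 0 1) ∧
        γ '' Ioo 0 1 ⊆ φ.imageᶜ := by
    obtain ⟨p, hp, q, hq, hpq, γ, h0, h1, hi, hγ⟩ := h
    obtain ⟨s, hs, rfl⟩ := aI ▸ hp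
    obtain ⟨t, ht, rfl⟩ := aI ▸ hq
    have hst : s ≠ t := fun h => hpq (congrArg a h)
    rcases hst.lt_or_gt with hst | hst
    · exact ⟨s, hs, t, ht, hst, γ, h0, h1, hi, hγ⟩
    -- The edge is cut in the order `x u v y`, so a chord that runs the other way is reversed.
    · obtain ⟨γ', r0, r1, ri, rI, -⟩ := exists_reverse γ
      exact ⟨t, ht, s, hs, hst, γ', r0.trans h1, r1.trans h0, ri hi, rI.trans_subset hγ⟩
  let A : ℕ → C(unitInterval, X) := fun
    | 0 => subarc a 0 s
    | 1 => subarc a s t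
    | 2 => subarc a t 1
    | _ => γ
  have l0 : A 0 '' Ioo 0 1 ⊆ a '' Ioo 0 1 := subarc_image_subset a hs.1
  have l1 : A 1 '' Ioo 0 1 ⊆ a '' Ioo 0 1 := subarc_image_subset a hst
  have l2 : A 2 '' Ioo 0 1 ⊆ a '' Ioo 0 1 := subarc_image_subset a ht.2
  have l3 : A 3 '' Ioo 0 1 ⊆ φ.imageᶜ := hγ
  have loc : ∀ i < 4, A i '' Ioo 0 1 ⊆ a '' Ioo 0 1 ∨ A i '' Ioo 0 1 ⊆ φ.imageᶜ := by
    intro i hi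
    interval_cases i <;> tauto
  have hp : ∀ i, (![a s, a t] : Fin 2 → X) i ∈ a '' Ioo 0 1 := by
    intro i
    fin_cases i
    exacts [mem_image_of_mem _ hs, mem_image_of_mem _ ht]
  refine ⟨φ.addEdge (.parallel e x y hl) ![a s, a t] A ?_ ?_ ?_ ?_ ?_ ?_ ?_ ?_ ?_⟩
  · have : a s ≠ a t := fun h => hst.ne (ai hs ht h)
    intro i j
    fin_cases i <;> fin_cases j <;> simp [this, this.symm]
  · intro i x hx hxi
    exact φ.vert_notMem_image_Ioo m hx (aI ▸ hxi ▸ hp i)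
  · intro i f hf hfs
    exact disjoint_left.1 (φ.disjoint_image_Ioo m hf (Ne.symm hfs)) (aI ▸ hp i)
  · intro i e hi
    have hi' : i < 4 := (List.getElem?_eq_some_iff.1 hi).1
    interval_cases i <;> simp only [EdgeAddition.newEnds, List.getElem?_cons_zero,
      List.getElem?_cons_succ, Option.some.injEq] at hi <;> subst hi <;>
      exact ⟨_, _, rfl, by simp [A, *], by simp [A, *]⟩
  · intro i hi
    change i < 4 at hi
    interval_cases i
    exacts [subarc_injOn a ai hs.1, subarc_injOn a ai hst, subarc_injOn a ai ht.2, hγi]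
  · intro i hi x hx hxa
    rcases loc i hi with hl | hl
    · exact φ.vert_notMem_image_Ioo m hx (aI ▸ hl hxa)
    · exact hl hxa (φ.vert_mem_image hx)
  · intro i hi j hj
    change i < 4 at hi
    have k := disjoint_right.1 c (hp j)
    fin_cases j <;> interval_cases i
    exacts [notMem_subarc_image ai hs hs.1 (by simp) hj,
      notMem_subarc_image ai hs hst (by simp) hj,
      notMem_subarc_image ai hs ht.2 (by simp [hst.le]) hj, k (l3 hj),
      notMem_subarc_image ai ht hs.1 (by simp [hst.le]) hj,
      notMem_subarc_image ai ht hst (by simp) hj, notMem_subarc_image ai ht ht.2 (by simp) hj,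
      k (l3 hj)]
  · intro i hi f hf hfs
    rcases loc i hi with hl | hl
    · exact (φ.disjoint_image_Ioo m hf (Ne.symm hfs)).mono_left (aI ▸ hl)
    · exact (disjoint_compl_image hf).mono_left hl
  · intro j hj i hij
    change j < 4 at hj
    interval_cases j <;> interval_cases i
    exacts [disjoint_subarc_image ai hs.1 hst le_rfl, disjoint_subarc_image ai hs.1 ht.2 hst.le,
      disjoint_subarc_image ai hst ht.2 le_rfl,
      (c.mono l3 l0).symm, (c.mono l3 l1).symm, (c.mono l3 l2).symm]

theorem nonempty_lollipop {e : β} (h : φ.HasLollipop e) {x y : α} (hl : G.IsLink e x y) :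
    Nonempty ((G.addEdge (.lollipop e x y hl)).SpaceEmbedding X) := by
  obtain ⟨p, hp, q, hq, γ, l, hγ0, hγ1, hl0, hl1, hγi, hli, hγ, hlc, hqγ, hql, hdis⟩ := h
  obtain ⟨a, a0, a1, ai, aI, -⟩ := φ.exists_oriented_arc hl
  have m := hl.edge_mem
  have c := disjoint_compl_image (φ := φ) m
  obtain ⟨s, hs, rfl⟩ := aI ▸ hp
  rw [← aI] at c hp
  let A : ℕ → C(unitInterval, X) := fun
    | 0 => subarc a 0 s
    | 1 => subarc a s 1
    | 2 => γ
    | _ => l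
  have l0 : A 0 '' Ioo 0 1 ⊆ a '' Ioo 0 1 := subarc_image_subset a hs.1
  have l1 : A 1 '' Ioo 0 1 ⊆ a '' Ioo 0 1 := subarc_image_subset a hs.2
  have l2 : A 2 '' Ioo 0 1 ⊆ φ.imageᶜ := hγ
  have l3 : A 3 '' Ioo 0 1 ⊆ φ.imageᶜ := hlc
  have loc : ∀ i < 4, A i '' Ioo 0 1 ⊆ a '' Ioo 0 1 ∨ A i '' Ioo 0 1 ⊆ φ.imageᶜ := by
    intro i hi
    interval_cases i <;> tauto
  have hpq : a s ≠ q := fun h => disjoint_right.1 c hp (h ▸ hq)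
  refine ⟨φ.addEdge (.lollipop e x y hl) ![a s, q] A ?_ ?_ ?_ ?_ ?_ ?_ ?_ ?_ ?_⟩
  · intro i j
    fin_cases i <;> fin_cases j <;> simp [hpq, hpq.symm]
  · intro i x hx hxi
    fin_cases i
    · exact φ.vert_notMem_image_Ioo m hx (aI ▸ hxi ▸ hp)
    · have hxq : φ.vert x = q := hxi
      exact hq (hxq ▸ φ.vert_mem_image hx)
  · intro i f hf hfs
    fin_cases i
    · exact disjoint_left.1 (φ.disjoint_image_Ioo m hf (Ne.symm hfs)) (aI ▸ hp)
    · exact disjoint_left.1 (disjoint_compl_image hf) hq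
  · intro i e hi
    have hi' : i < 4 := (List.getElem?_eq_some_iff.1 hi).1
    interval_cases i <;> simp only [EdgeAddition.newEnds, List.getElem?_cons_zero,
      List.getElem?_cons_succ, Option.some.injEq] at hi <;> subst hi <;>
      exact ⟨_, _, rfl, by simp [A, *], by simp [A, *]⟩
  · intro i hi
    change i < 4 at hi
    interval_cases i
    exacts [subarc_injOn a ai hs.1, subarc_injOn a ai hs.2, hγi, hli]
  · intro i hi x hx hxa
    rcases loc i hi with hl | hl
    · exact φ.vert_notMem_image_Ioo m hx (aI ▸ hl hxa)
    · exact hl hxa (φ.vert_mem_image hx)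
  · intro i hi j hj
    change i < 4 at hi
    have k := disjoint_right.1 c hp
    have k' := disjoint_left.1 c hq
    fin_cases j <;> interval_cases i
    exacts [notMem_subarc_image ai hs hs.1 (by simp) hj,
      notMem_subarc_image ai hs hs.2 (by simp) hj, k (l2 hj), k (l3 hj), k' (l0 hj), k' (l1 hj),
      hqγ hj, hql hj]
  · intro i hi f hf hfs
    rcases loc i hi with hl | hl
    · exact (φ.disjoint_image_Ioo m hf (Ne.symm hfs)).mono_left (aI ▸ hl)
    · exact (disjoint_compl_image hf).mono_left hl
  · intro j hj i hij
    change j < 4 at hj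
    interval_cases j <;> interval_cases i
    exacts [disjoint_subarc_image ai hs.1 hs.2 le_rfl,
      (c.mono l2 l0).symm, (c.mono l2 l1).symm, (c.mono l3 l0).symm, (c.mono l3 l1).symm, hdis]

end SpaceEmbedding

end Graph

/-! ### Plane geometry and the covering of the torus by the plane -/

/-- Twice the signed area of the triangle `p q z`. -/
def signedArea {R : Type*} [Sub R] [Mul R] (p q z : R × R) : R :=
  (q.1 - p.1) * (z.2 - p.2) - (q.2 - p.2) * (z.1 - p.1)

/-- The point that divides the segment from `p` to `q` in the ratio `t : 1 - t`. -/
def lerp (p q : ℝ × ℝ) (t : ℝ) : ℝ × ℝ :=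
  ((1 - t) * p.1 + t * q.1, (1 - t) * p.2 + t * q.2)

/-- A lattice point as a point of the plane. -/
def latticePoint (p : ℤ × ℤ) : ℝ × ℝ := (p.1, p.2)

theorem signedArea_latticePoint (p q z : ℤ × ℤ) :
    signedArea (latticePoint p) (latticePoint q) (latticePoint z) = (signedArea p q z : ℤ) := by
  simp [signedArea, latticePoint]

theorem signedArea_lerp (p q a b : ℝ × ℝ) (t : ℝ) :
    signedArea p q (lerp a b t) = (1 - t) * signedArea p q a + t * signedArea p q b := by
  simp only [signedArea, lerp]; ring

@[simp] theorem signedArea_left (p q : ℝ × ℝ) : signedArea p q p = 0 := by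
  simp [signedArea]

@[simp] theorem signedArea_right (p q : ℝ × ℝ) : signedArea p q q = 0 := by
  simp only [signedArea]; ring

@[simp] theorem lerp_zero (p q : ℝ × ℝ) : lerp p q 0 = p := by simp [lerp]

@[simp] theorem lerp_one (p q : ℝ × ℝ) : lerp p q 1 = q := by simp [lerp]

@[fun_prop]
theorem Continuous.lerp {Y : Type*} [TopologicalSpace Y] {p q : Y → ℝ × ℝ} {t : Y → ℝ}
    (hp : Continuous p) (hq : Continuous q) (ht : Continuous t) :
    Continuous fun y => _root_.lerp (p y) (q y) (t y) := by
  unfold _root_.lerp; fun_prop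

theorem lerp_comm (p q : ℝ × ℝ) (t : ℝ) : lerp p q t = lerp q p (1 - t) := by
  ext <;> simp only [lerp] <;> ring

/-- The covering of the torus by the plane with the lattice `8ℤ²` as its group of translations. -/
noncomputable def gridTorus (z : ℝ × ℝ) : UnitAddTorus (Fin 2) :=
  ![((z.1 / 8 : ℝ) : UnitAddCircle), ((z.2 / 8 : ℝ) : UnitAddCircle)]

theorem unitAddCircle_coe_div_eq_iff {x y : ℝ} :
    ((x / 8 : ℝ) : UnitAddCircle) = ((y / 8 : ℝ) : UnitAddCircle) ↔ ∃ m : ℤ, x = y + 8 * m := by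
  rw [← sub_eq_zero, ← AddCircle.coe_sub, AddCircle.coe_eq_zero_iff]
  refine exists_congr fun m => ?_
  rw [zsmul_one]
  constructor <;> intro h <;> linarith

theorem gridTorus_eq_iff {z w : ℝ × ℝ} :
    gridTorus z = gridTorus w ↔ ∃ m n : ℤ, z.1 = w.1 + 8 * m ∧ z.2 = w.2 + 8 * n := by
  simp only [gridTorus, funext_iff, Fin.forall_fin_two, Matrix.cons_val_zero, Matrix.cons_val_one,
    unitAddCircle_coe_div_eq_iff]
  constructor
  · rintro ⟨⟨m, hm⟩, n, hn⟩
    exact ⟨m, n, hm, hn⟩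
  · rintro ⟨m, n, hm, hn⟩
    exact ⟨⟨m, hm⟩, n, hn⟩

@[fun_prop]
theorem continuous_gridTorus : Continuous gridTorus := by
  refine continuous_pi fun i => ?_
  have h : ∀ f : ℝ × ℝ → ℝ, Continuous f → Continuous fun z => ((f z : ℝ) : UnitAddCircle) :=
    fun f hf => (AddCircle.continuous_mk' 1).comp hf
  fin_cases i
  · exact h (fun z => z.1 / 8) (by fun_prop)
  · exact h (fun z => z.2 / 8) (by fun_prop)

/-- Openness makes the image of an open polygon open, as is needed to recognize it as a component of
the complement. -/
theorem isOpenMap_gridTorus : IsOpenMap gridTorus := by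
  let e : ℝ × ℝ ≃ₜ (Fin 2 → ℝ) :=
    ((Homeomorph.mulRight₀ (8⁻¹ : ℝ) (by norm_num)).prodCongr
      (Homeomorph.mulRight₀ (8⁻¹ : ℝ) (by norm_num))).trans Homeomorph.finTwoArrow.symm
  have h : IsOpenMap fun f : Fin 2 → ℝ => fun i => ((f i : ℝ) : UnitAddCircle) :=
    IsOpenMap.piMap (fun _ => QuotientAddGroup.isOpenMap_coe) (by simp)
  convert h.comp e.isOpenMap using 1
  ext z i
  fin_cases i <;> simp [gridTorus, e, div_eq_mul_inv]

/-- Translation by an element of `8ℤ²`. -/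
def gridTranslate (m n : ℤ) (p : ℤ × ℤ) : ℤ × ℤ := (p.1 + 8 * m, p.2 + 8 * n)

/-- The range of translations that have to be considered for points of the box. -/
def gridSteps : List ℤ := [-2, -1, 0, 1, 2]

/-- Two coordinates in an interval of length 16 that differ by `8m` force `|m| ≤ 2`; this makes all
later checks over translates finite. -/
theorem mem_gridSteps {m : ℤ} {a b : ℝ} (ha : a ∈ Icc (-4 : ℝ) 12) (hb : b ∈ Icc (-4 : ℝ) 12)
    (h : a = b + 8 * m) : m ∈ gridSteps := by
  have h1 : (m : ℝ) ≤ (2 : ℤ) := by push_cast; linarith [ha.2, hb.1]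
  have h2 : ((-2 : ℤ) : ℝ) ≤ m := by push_cast; linarith [ha.1, hb.2]
  have h1 : m ≤ 2 := by exact_mod_cast h1
  have h2 : -2 ≤ m := by exact_mod_cast h2
  simp only [gridSteps, List.mem_cons, List.not_mem_nil]
  omega

/-- The lattice points of a square that is large enough to hold a drawing. -/
def InBox (p : ℤ × ℤ) : Prop := (-4 ≤ p.1 ∧ p.1 ≤ 12) ∧ (-4 ≤ p.2 ∧ p.2 ≤ 12)

instance (p : ℤ × ℤ) : Decidable (InBox p) := by unfold InBox; infer_instance

theorem lerp_mem_box {p q : ℤ × ℤ} (hp : InBox p) (hq : InBox q) {t : ℝ} (ht : t ∈ Icc (0 : ℝ) 1) :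
    (lerp (latticePoint p) (latticePoint q) t).1 ∈ Icc (-4 : ℝ) 12 ∧
      (lerp (latticePoint p) (latticePoint q) t).2 ∈ Icc (-4 : ℝ) 12 := by
  have key : ∀ a b : ℤ, (-4 ≤ a ∧ a ≤ 12) → (-4 ≤ b ∧ b ≤ 12) →
      (1 - t) * (a : ℝ) + t * b ∈ Icc (-4 : ℝ) 12 := by
    rintro a b ⟨ha, ha'⟩ ⟨hb, hb'⟩
    have ha : (-4 : ℝ) ≤ a := by exact_mod_cast ha
    have ha' : (a : ℝ) ≤ 12 := by exact_mod_cast ha'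
    have hb : (-4 : ℝ) ≤ b := by exact_mod_cast hb
    have hb' : (b : ℝ) ≤ 12 := by exact_mod_cast hb'
    exact convex_Icc (-4 : ℝ) 12 ⟨ha, ha'⟩ ⟨hb, hb'⟩ (sub_nonneg.2 ht.2) ht.1 (by ring)
  exact ⟨key _ _ hp.1 hq.1, key _ _ hp.2 hq.2⟩

/-- A certificate that the open segment `p q` does not meet the closed segment `p' q'`: the ends of
one segment lie on the same side of the other. -/
def SegmentsApart (p q p' q' : ℤ × ℤ) : Prop :=
  (0 ≤ signedArea p' q' p ∧ 0 ≤ signedArea p' q' q ∧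
    0 < signedArea p' q' p + signedArea p' q' q) ∨
  (signedArea p' q' p ≤ 0 ∧ signedArea p' q' q ≤ 0 ∧
    signedArea p' q' p + signedArea p' q' q < 0) ∨
  (0 < signedArea p q p' ∧ 0 < signedArea p q q') ∨ (signedArea p q p' < 0 ∧ signedArea p q q' < 0)

instance (p q p' q' : ℤ × ℤ) : Decidable (SegmentsApart p q p' q') := by
  unfold SegmentsApart; infer_instance

theorem convexComb_pos {t a b : ℝ} (ht : t ∈ Ioo (0 : ℝ) 1) (ha : 0 ≤ a) (hb : 0 ≤ b)
    (hab : 0 < a + b) : 0 < (1 - t) * a + t * b := by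
  have h1 := sub_pos.2 ht.2
  rcases ha.eq_or_lt with rfl | ha
  · have := mul_pos ht.1 (by simpa using hab : 0 < b)
    linarith
  · have := mul_pos h1 ha
    have := mul_nonneg ht.1.le hb
    linarith

theorem SegmentsApart.lerp_ne {p q p' q' : ℤ × ℤ} (h : SegmentsApart p q p' q') {s t : ℝ}
    (hs : s ∈ Ioo (0 : ℝ) 1) (ht : t ∈ Icc (0 : ℝ) 1) :
    lerp (latticePoint p) (latticePoint q) s ≠ lerp (latticePoint p') (latticePoint q') t := by
  intro he
  -- A common point lies on both lines, so each area function vanishes there; its value is also a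
  -- convex combination of the values at the ends of the other segment, which the certificate makes
  -- nonzero. In the first two alternatives one end of `p q` may lie on the line, since `s` is
  -- strictly between 0 and 1.
  have h1 := congrArg (signedArea (latticePoint p') (latticePoint q')) he
  have h2 := congrArg (signedArea (latticePoint p) (latticePoint q)) he
  simp only [signedArea_lerp, signedArea_left, signedArea_right, signedArea_latticePoint, mul_zero,
    add_zero] at h1 h2
  have h3 := sub_nonneg.2 ht.2
  rcases h with ⟨ha, hb, hab⟩ | ⟨ha, hb, hab⟩ | ⟨ha, hb⟩ | ⟨ha, hb⟩
  · have := convexComb_pos (a := (signedArea p' q' p : ℤ)) (b := (signedArea p' q' q : ℤ)) hs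
      (by exact_mod_cast ha) (by exact_mod_cast hb) (by exact_mod_cast hab)
    exact this.ne' h1
  · have := convexComb_pos (a := -(signedArea p' q' p : ℤ)) (b := -(signedArea p' q' q : ℤ)) hs
      (by simpa using (by exact_mod_cast ha : ((signedArea p' q' p : ℤ) : ℝ) ≤ 0))
      (by simpa using (by exact_mod_cast hb : ((signedArea p' q' q : ℤ) : ℝ) ≤ 0))
      (by have : ((signedArea p' q' p : ℤ) : ℝ) + (signedArea p' q' q : ℤ) < 0 := by
            exact_mod_cast hab
          linarith)
    linarith
  · have ha : (0 : ℝ) < (signedArea p q p' : ℤ) := by exact_mod_cast ha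
    have hb : (0 : ℝ) < (signedArea p q q' : ℤ) := by exact_mod_cast hb
    have := convex_Ioi (0 : ℝ) ha hb h3 ht.1 (by ring)
    exact (mem_Ioi.1 this).ne h2
  · have ha : ((signedArea p q p' : ℤ) : ℝ) < 0 := by exact_mod_cast ha
    have hb : ((signedArea p q q' : ℤ) : ℝ) < 0 := by exact_mod_cast hb
    have := convex_Iio (0 : ℝ) ha hb h3 ht.1 (by ring)
    exact (mem_Iio.1 this).ne h2.symm

theorem lerp_gridTranslate (m n : ℤ) (p q : ℤ × ℤ) (t : ℝ) :
    lerp (latticePoint (gridTranslate m n p)) (latticePoint (gridTranslate m n q)) t =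
      ((lerp (latticePoint p) (latticePoint q) t).1 + 8 * m,
        (lerp (latticePoint p) (latticePoint q) t).2 + 8 * n) := by
  ext <;> simp only [lerp, latticePoint, gridTranslate] <;> push_cast <;> ring

/-! ### Straight-line drawings on the torus -/

/-- A drawing with straight edges on the torus, given by lifts of the edges to the plane. -/
structure TorusDrawing (κ : Type*) where
  tail : κ → ℤ × ℤ
  head : κ → ℤ × ℤ
  inBox : ∀ k, InBox (tail k) ∧ InBox (head k)
  ne : ∀ k, tail k ≠ head k
  short : ∀ k, |(head k).1 - (tail k).1| < 8 ∧ |(head k).2 - (tail k).2| < 8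
  apart : ∀ k l, k ≠ l → ∀ m ∈ gridSteps, ∀ n ∈ gridSteps,
    SegmentsApart (tail k) (head k) (gridTranslate m n (tail l)) (gridTranslate m n (head l))

namespace TorusDrawing

variable {κ : Type*} (D : TorusDrawing κ)

/-- The lift of an edge, parametrized by its length. -/
def lift (k : κ) (t : ℝ) : ℝ × ℝ := lerp (latticePoint (D.tail k)) (latticePoint (D.head k)) t

/-- An edge on the torus. -/
noncomputable def arc (k : κ) : C(unitInterval, UnitAddTorus (Fin 2)) where
  toFun t := gridTorus (D.lift k t)
  continuous_toFun := by unfold lift; fun_prop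

/-- The union of the edges. -/
def image : Set (UnitAddTorus (Fin 2)) := ⋃ k, range (D.arc k)

/-- If two parameters have the same image, then `(s - t) * (head - tail)` lies in `8ℤ²`. Its
coordinates are less than 8 in absolute value by `short`, so it vanishes, and `head ≠ tail` gives `s
= t`. -/
theorem arc_injOn (k : κ) : InjOn (D.arc k) (Ioo 0 1) := by
  intro s hs t ht h
  obtain ⟨m, n, hm, hn⟩ := gridTorus_eq_iff.1 h
  have hst : |(s : ℝ) - t| < 1 := by
    have h1 : (0 : ℝ) < s := hs.1
    have h2 : (s : ℝ) < 1 := hs.2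
    have h3 : (0 : ℝ) < t := ht.1
    have h4 : (t : ℝ) < 1 := ht.2
    rw [abs_lt]; constructor <;> linarith
  have key : ∀ {a b j : ℤ}, |b - a| < 8 →
      (1 - (s : ℝ)) * a + s * b = (1 - (t : ℝ)) * a + t * b + 8 * j →
      ((s : ℝ) - t) * (b - a) = 0 := by
    intro a b j hab he
    have hab' : |(b : ℝ) - a| < 8 := by exact_mod_cast hab
    have he' : ((s : ℝ) - t) * (b - a) = 8 * j := by linarith
    have hlt : |(8 * j : ℝ)| < 8 := by
      rw [← he', abs_mul]
      nlinarith [abs_nonneg ((s : ℝ) - t), abs_nonneg ((b : ℝ) - a)]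
    rw [abs_mul, abs_of_pos (by norm_num : (0 : ℝ) < 8)] at hlt
    have : |(j : ℝ)| < 1 := by linarith
    have hj : j = 0 := Int.abs_lt_one_iff.1 (by exact_mod_cast this)
    rw [he', hj]; simp
  have h1 := key (D.short k).1 hm
  have h2 := key (D.short k).2 hn
  by_contra hne
  have hne' : (s : ℝ) - t ≠ 0 := sub_ne_zero.2 fun h => hne (Subtype.ext h)
  refine D.ne k (Prod.ext ?_ ?_)
  · have := (mul_eq_zero.1 h1).resolve_left hne'
    exact_mod_cast (sub_eq_zero.1 this).symm
  · have := (mul_eq_zero.1 h2).resolve_left hne'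
    exact_mod_cast (sub_eq_zero.1 this).symm

theorem lift_mem_box (k : κ) {t : ℝ} (ht : t ∈ Icc (0 : ℝ) 1) :
    (D.lift k t).1 ∈ Icc (-4 : ℝ) 12 ∧ (D.lift k t).2 ∈ Icc (-4 : ℝ) 12 :=
  lerp_mem_box (D.inBox k).1 (D.inBox k).2 ht

/-- The second parameter may be an end of the interval. The same certificate thus keeps open edges
away from vertices as well as from each other. -/
theorem arc_ne_arc {k l : κ} (hkl : k ≠ l) {s : unitInterval} (hs : s ∈ Ioo 0 1)
    (t : unitInterval) : D.arc k s ≠ D.arc l t := by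
  intro h
  obtain ⟨m, n, hm, hn⟩ := gridTorus_eq_iff.1 h
  have hk := D.lift_mem_box k s.2
  have hl := D.lift_mem_box l t.2
  have ha := D.apart k l hkl m (mem_gridSteps hk.1 hl.1 hm) n (mem_gridSteps hk.2 hl.2 hn)
  refine ha.lerp_ne (s := s) (t := t) ⟨hs.1, hs.2⟩ t.2 ?_
  rw [lerp_gridTranslate]
  exact Prod.ext hm hn

end TorusDrawing

/-! ### Faces as images of convex lattice polygons -/

/-- A certificate that the signed area with base `p q` is nonnegative on a convex polygon: it is
so at a corner at which it attains its minimum. -/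
def NonnegOnPolygon {n : ℕ} [NeZero n] (v : Fin n → ℤ × ℤ) (p q : ℤ × ℤ) : Prop :=
  ∃ i, 0 < signedArea (v i) (v (i + 1)) (v (i + 1 + 1)) ∧ 0 ≤ signedArea p q (v (i + 1)) ∧
    0 ≤ (q.1 - p.1) * ((v (i + 1 + 1)).2 - (v (i + 1)).2) -
      (q.2 - p.2) * ((v (i + 1 + 1)).1 - (v (i + 1)).1) ∧
    0 ≤ ((v (i + 1)).1 - (v i).1) * (q.2 - p.2) - ((v (i + 1)).2 - (v i).2) * (q.1 - p.1)

instance {n : ℕ} [NeZero n] (v : Fin n → ℤ × ℤ) (p q : ℤ × ℤ) :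
    Decidable (NonnegOnPolygon v p q) := by
  unfold NonnegOnPolygon; infer_instance

theorem NonnegOnPolygon.signedArea_nonneg {n : ℕ} [NeZero n] {v : Fin n → ℤ × ℤ} {p q : ℤ × ℤ}
    (h : NonnegOnPolygon v p q) {z : ℝ × ℝ}
    (hz : ∀ i, 0 ≤ signedArea (latticePoint (v i)) (latticePoint (v (i + 1))) z) :
    0 ≤ signedArea (latticePoint p) (latticePoint q) z := by
  obtain ⟨i, h1, h2, h3, h4⟩ := h
  have h1 : (0 : ℝ) < (signedArea (v i) (v (i + 1)) (v (i + 1 + 1)) : ℤ) := by exact_mod_cast h1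
  have h2 : (0 : ℝ) ≤ (signedArea p q (v (i + 1)) : ℤ) := by exact_mod_cast h2
  -- Cramer's rule: the direction `q - p` is a nonnegative combination of the two sides that meet at
  -- the corner `v (i + 1)`. After multiplication by the cross product of these sides, the area at
  -- `z` is the area at the corner plus the same combination of the two heights of `z`.
  have h3' := mul_nonneg (Int.cast_nonneg (R := ℝ) h3) (hz i)
  have h4' := mul_nonneg (Int.cast_nonneg (R := ℝ) h4) (hz (i + 1))
  have h5 := mul_nonneg h1.le h2
  refine nonneg_of_mul_nonneg_right ?_ h1
  have := add_nonneg (add_nonneg h3' h4') h5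
  convert this using 1
  simp only [signedArea, latticePoint]
  push_cast
  ring

namespace TorusDrawing

variable {κ : Type*} (D : TorusDrawing κ)

/-- A strictly convex polygon in the plane that is a lift of a face of the drawing. The corners are
in counterclockwise order. -/
structure Face (n : ℕ) [NeZero n] where
  corner : Fin n → ℤ × ℤ
  side : Fin n → κ
  succ_ne : ∀ i : Fin n, i + 1 ≠ i
  convex : ∀ i j, 0 ≤ signedArea (corner i) (corner (i + 1)) (corner j)
  strict : ∀ i j, i ≠ j → 0 < signedArea (corner i) (corner (i + 1)) (corner j) +
    signedArea (corner i) (corner (i + 1)) (corner (j + 1))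
  side_eq : ∀ i, ∃ m ∈ gridSteps, ∃ n ∈ gridSteps,
    (corner i = gridTranslate m n (D.tail (side i)) ∧
      corner (i + 1) = gridTranslate m n (D.head (side i))) ∨
    (corner i = gridTranslate m n (D.head (side i)) ∧
      corner (i + 1) = gridTranslate m n (D.tail (side i)))
  box : NonnegOnPolygon corner (-4, 0) (-4, -1) ∧ NonnegOnPolygon corner (12, 0) (12, 1) ∧
    NonnegOnPolygon corner (0, -4) (1, -4) ∧ NonnegOnPolygon corner (0, 12) (-1, 12)
  avoid : ∀ k, ∀ m ∈ gridSteps, ∀ n ∈ gridSteps, ∃ i,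
    signedArea (corner i) (corner (i + 1)) (gridTranslate m n (D.tail k)) ≤ 0 ∧
      signedArea (corner i) (corner (i + 1)) (gridTranslate m n (D.head k)) ≤ 0
  avoid_self : ∀ m ∈ gridSteps, ∀ n ∈ gridSteps, m ≠ 0 ∨ n ≠ 0 → ∃ i,
    NonnegOnPolygon corner (gridTranslate m n (corner (i + 1))) (gridTranslate m n (corner i))

namespace Face

variable {D} {n : ℕ} [NeZero n] (F : D.Face n)

/-- The signed area with the side `i` as base. -/
def height (i : Fin n) (z : ℝ × ℝ) : ℝ :=
  signedArea (latticePoint (F.corner i)) (latticePoint (F.corner (i + 1))) z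

/-- The point on the side `i` that divides it in the ratio `t : 1 - t`. -/
def onSide (i : Fin n) (t : ℝ) : ℝ × ℝ :=
  lerp (latticePoint (F.corner i)) (latticePoint (F.corner (i + 1))) t

/-- The open polygon. -/
def interior : Set (ℝ × ℝ) := {z | ∀ i, 0 < F.height i z}

/-- The closed polygon. -/
def closedPolygon : Set (ℝ × ℝ) := {z | ∀ i, 0 ≤ F.height i z}

theorem interior_subset : F.interior ⊆ F.closedPolygon := fun _ hz i => (hz i).le

theorem height_lerp (i : Fin n) (a b : ℝ × ℝ) (t : ℝ) :
    F.height i (lerp a b t) = (1 - t) * F.height i a + t * F.height i b :=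
  signedArea_lerp _ _ _ _ _

theorem height_corner_nonneg (i j : Fin n) : 0 ≤ F.height i (latticePoint (F.corner j)) := by
  rw [height, signedArea_latticePoint]
  exact_mod_cast F.convex i j

theorem height_onSide_self (i : Fin n) (t : ℝ) : F.height i (F.onSide i t) = 0 := by
  rw [onSide, height_lerp]
  simp [height]

theorem height_onSide_nonneg (i j : Fin n) {t : ℝ} (ht : t ∈ Icc (0 : ℝ) 1) :
    0 ≤ F.height i (F.onSide j t) := by
  rw [onSide, height_lerp]
  exact add_nonneg (mul_nonneg (sub_nonneg.2 ht.2) (F.height_corner_nonneg i j))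
    (mul_nonneg ht.1 (F.height_corner_nonneg i (j + 1)))

theorem height_corner_add_pos {i j : Fin n} (h : i ≠ j) :
    0 < F.height i (latticePoint (F.corner j)) + F.height i (latticePoint (F.corner (j + 1))) := by
  rw [height, height, signedArea_latticePoint, signedArea_latticePoint]
  exact_mod_cast F.strict i j h

theorem height_onSide_pos {i j : Fin n} (h : i ≠ j) {t : ℝ} (ht : t ∈ Ioo (0 : ℝ) 1) :
    0 < F.height i (F.onSide j t) := by
  rw [onSide, height_lerp]
  exact convexComb_pos ht (F.height_corner_nonneg i j) (F.height_corner_nonneg i (j + 1))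
    (F.height_corner_add_pos h)

/-- A chord between two sides runs in the open polygon. -/
theorem lerp_onSide_mem_interior {i j : Fin n} (h : i ≠ j) {s s' t : ℝ} (hs : s ∈ Ioo (0 : ℝ) 1)
    (hs' : s' ∈ Ioo (0 : ℝ) 1) (ht : t ∈ Ioo (0 : ℝ) 1) :
    lerp (F.onSide i s) (F.onSide j s') t ∈ F.interior := by
  intro k
  have h1 := F.height_onSide_nonneg k i (Ioo_subset_Icc_self hs)
  have h2 := F.height_onSide_nonneg k j (Ioo_subset_Icc_self hs')
  rw [height_lerp]
  refine convexComb_pos ht h1 h2 ?_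
  by_cases hk : k = i
  · exact add_pos_of_nonneg_of_pos h1 (F.height_onSide_pos (hk ▸ h) hs')
  · exact add_pos_of_pos_of_nonneg (F.height_onSide_pos hk hs) h2

theorem interior_nonempty : F.interior.Nonempty :=
  have h : (1 / 2 : ℝ) ∈ Ioo (0 : ℝ) 1 := by constructor <;> norm_num
  ⟨_, F.lerp_onSide_mem_interior (F.succ_ne 0) h h h⟩

theorem mem_box {z : ℝ × ℝ} (hz : z ∈ F.closedPolygon) :
    z.1 ∈ Icc (-4 : ℝ) 12 ∧ z.2 ∈ Icc (-4 : ℝ) 12 := by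
  obtain ⟨h1, h2, h3, h4⟩ := F.box
  have h1 := h1.signedArea_nonneg hz
  have h2 := h2.signedArea_nonneg hz
  have h3 := h3.signedArea_nonneg hz
  have h4 := h4.signedArea_nonneg hz
  simp only [signedArea, latticePoint] at h1 h2 h3 h4
  push_cast at h1 h2 h3 h4
  refine ⟨⟨?_, ?_⟩, ?_, ?_⟩ <;> linarith

/-- By `avoid`, each relevant lift of an edge lies weakly outside some side of the polygon, whereas
interior points lie strictly inside every side. -/
theorem gridTorus_notMem_image {z : ℝ × ℝ} (hz : z ∈ F.interior) : gridTorus z ∉ D.image := by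
  intro h
  obtain ⟨k, t, h⟩ := mem_iUnion.1 h
  obtain ⟨m, n, hm, hn⟩ := gridTorus_eq_iff.1 (show gridTorus z = _ from h.symm)
  have hb := F.mem_box (F.interior_subset hz)
  have hl := D.lift_mem_box k t.2
  obtain ⟨i, h1, h2⟩ := F.avoid k m (mem_gridSteps hb.1 hl.1 hm) n (mem_gridSteps hb.2 hl.2 hn)
  have he : z = lerp (latticePoint (gridTranslate m n (D.tail k)))
      (latticePoint (gridTranslate m n (D.head k))) t := by
    rw [lerp_gridTranslate]
    exact Prod.ext hm hn
  have hi := hz i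
  rw [he, height_lerp, height, height, signedArea_latticePoint, signedArea_latticePoint] at hi
  have h1 := mul_nonpos_of_nonneg_of_nonpos (sub_nonneg.2 t.2.2) (Int.cast_nonpos (R := ℝ).2 h1)
  have h2 := mul_nonpos_of_nonneg_of_nonpos t.2.1 (Int.cast_nonpos (R := ℝ).2 h2)
  linarith

/-- For a nonzero translation, `avoid_self` gives a side whose translate has the original polygon
weakly on its outer side. The translate of an interior point is strictly on its inner side, so the
two interiors are disjoint. -/
theorem gridTorus_injOn : InjOn gridTorus F.interior := by
  intro z hz w hw h
  obtain ⟨m, n, hm, hn⟩ := gridTorus_eq_iff.1 h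
  have hzb := F.mem_box (F.interior_subset hz)
  have hwb := F.mem_box (F.interior_subset hw)
  by_cases hmn : m ≠ 0 ∨ n ≠ 0
  · obtain ⟨i, hi⟩ := F.avoid_self m (mem_gridSteps hzb.1 hwb.1 hm) n
      (mem_gridSteps hzb.2 hwb.2 hn) hmn
    have h1 := hi.signedArea_nonneg (F.interior_subset hz)
    have h2 := hw i
    simp only [height, signedArea, latticePoint, gridTranslate] at h1 h2
    rw [hm, hn] at h1
    push_cast at h1
    linarith
  · push Not at hmn
    obtain ⟨rfl, rfl⟩ := hmn
    exact Prod.ext (by simpa using hm) (by simpa using hn)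

theorem side_image (i : Fin n) :
    (∀ t : unitInterval, gridTorus (F.onSide i t) = D.arc (F.side i) t) ∨
      ∀ t : unitInterval, gridTorus (F.onSide i t) = D.arc (F.side i) (unitInterval.symm t) := by
  obtain ⟨m, -, n, -, ⟨h1, h2⟩ | ⟨h1, h2⟩⟩ := F.side_eq i
  · refine .inl fun t => gridTorus_eq_iff.2 ⟨m, n, ?_⟩
    rw [onSide, h1, h2, lerp_gridTranslate]
    exact ⟨rfl, rfl⟩
  · refine .inr fun t => gridTorus_eq_iff.2 ⟨m, n, ?_⟩
    rw [onSide, h1, h2, lerp_gridTranslate, lerp_comm, ← unitInterval.coe_symm_eq]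
    exact ⟨rfl, rfl⟩

theorem onSide_mem_arc_image (i : Fin n) {t : ℝ} (ht : t ∈ Ioo (0 : ℝ) 1) :
    gridTorus (F.onSide i t) ∈ D.arc (F.side i) '' Ioo 0 1 := by
  lift t to unitInterval using Ioo_subset_Icc_self ht
  rcases F.side_image i with h | h
  · exact ⟨t, ht, (h t).symm⟩
  · refine ⟨_, ⟨unitInterval.pos_iff_ne_zero.2 ?_, unitInterval.lt_one_iff_ne_one.2 ?_⟩,
      (h t).symm⟩
    · simpa using (show t < 1 from ht.2).ne
    · simpa using (show 0 < t from ht.1).ne'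

theorem range_arc_side (i : Fin n) :
    range (D.arc (F.side i)) = gridTorus '' (F.onSide i '' Icc 0 1) := by
  rw [image_image, ← image_univ (f := D.arc _)]
  rcases F.side_image i with h | h
  · ext z
    constructor
    · rintro ⟨t, -, rfl⟩
      exact ⟨t, t.2, h t⟩
    · rintro ⟨t, ht, rfl⟩
      exact ⟨⟨t, ht⟩, trivial, (h ⟨t, ht⟩).symm⟩
  · ext z
    constructor
    · rintro ⟨t, -, rfl⟩
      exact ⟨_, (unitInterval.symm t).2, (h _).trans (by rw [unitInterval.symm_symm])⟩
    · rintro ⟨t, ht, rfl⟩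
      exact ⟨_, trivial, (h ⟨t, ht⟩).symm⟩

/-- The point of the triangle with base side `i` and apex `c` that divides in the ratio `s : 1 - s`
the segment from a point of the base to the apex. -/
def fan (c : ℝ × ℝ) (i : Fin n) (r s : ℝ) : ℝ × ℝ := lerp (F.onSide i r) c s

theorem fan_mem_interior {c : ℝ × ℝ} (hc : c ∈ F.interior) (i : Fin n) {r s : ℝ}
    (hr : r ∈ Icc (0 : ℝ) 1) (hs : s ∈ Ioo (0 : ℝ) 1) : F.fan c i r s ∈ F.interior := by
  intro k
  rw [fan, height_lerp]
  have h := F.height_onSide_nonneg k i hr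
  exact convexComb_pos hs h (hc k).le (add_pos_of_nonneg_of_pos h (hc k))

/-- The height over the base is `s` times the height of the apex, which recovers `s`. Away from the
apex the point of the base can then be recovered too. Curves in a face can thus be described by the
coordinates `(r, s)`. -/
theorem fan_injective {c : ℝ × ℝ} (hc : c ∈ F.interior) {i : Fin n} {r s r' s' : ℝ} (hs : s < 1)
    (h : F.fan c i r s = F.fan c i r' s') : r = r' ∧ s = s' := by
  have hci := hc i
  have h1 := congrArg (F.height i) h
  rw [fan, fan, height_lerp, height_lerp, height_onSide_self, height_onSide_self, mul_zero,
    mul_zero, zero_add, zero_add] at h1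
  obtain rfl := mul_right_cancel₀ hci.ne' h1
  refine ⟨?_, rfl⟩
  have hs' : 1 - s ≠ 0 := (sub_pos.2 hs).ne'
  have h2 := congrArg Prod.fst h
  have h3 := congrArg Prod.snd h
  simp only [fan, lerp, onSide, add_left_inj] at h2 h3
  have h2 := mul_left_cancel₀ hs' h2
  have h3 := mul_left_cancel₀ hs' h3
  simp only [height, signedArea] at hci
  by_contra hne
  have hne' : r - r' ≠ 0 := sub_ne_zero.2 hne
  have h2' := (mul_eq_zero.1 (show (r - r') * ((latticePoint (F.corner (i + 1))).1 -
    (latticePoint (F.corner i)).1) = 0 by linarith)).resolve_left hne'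
  have h3' := (mul_eq_zero.1 (show (r - r') * ((latticePoint (F.corner (i + 1))).2 -
    (latticePoint (F.corner i)).2) = 0 by linarith)).resolve_left hne'
  rw [h2', h3'] at hci
  simp at hci

end Face

end TorusDrawing

/-! ### Frontier and connected component of a face -/

namespace TorusDrawing.Face

variable {κ : Type*} {D : TorusDrawing κ} {n : ℕ} [NeZero n] (F : D.Face n)

/-- Height zero puts `z` on the line through the side, at some parameter `t`. The heights over the
previous and the next side are positive multiples of `t` and `1 - t`, so their nonnegativity
confines `t` to the unit interval. -/
theorem mem_onSide {z : ℝ × ℝ} (hz : z ∈ F.closedPolygon) {i : Fin n} (hi : F.height i z = 0) :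
    z ∈ F.onSide i '' Icc 0 1 := by
  set p := latticePoint (F.corner i) with hp
  set q := latticePoint (F.corner (i + 1)) with hq
  have hprev : 0 < F.height (i - 1) q := by
    have h := F.height_corner_add_pos (i := i - 1) (j := i) fun h =>
      F.succ_ne (i - 1) (by rw [sub_add_cancel, h])
    have h0 : F.height (i - 1) p = 0 := by
      rw [height, sub_add_cancel]
      exact signedArea_right _ _
    linarith
  have hnext : 0 < F.height (i + 1) p := by
    have h := F.height_corner_add_pos (F.succ_ne i)
    have h0 : F.height (i + 1) q = 0 := signedArea_left _ _
    linarith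
  have hpq : ∃ t, z = lerp p q t := by
    change (q.1 - p.1) * (z.2 - p.2) - (q.2 - p.2) * (z.1 - p.1) = 0 at hi
    by_cases h1 : q.1 - p.1 = 0
    · have h2 : q.2 - p.2 ≠ 0 := by
        intro h2
        have : q = p := Prod.ext (sub_eq_zero.1 h1) (sub_eq_zero.1 h2)
        rw [← this] at hnext
        exact hnext.ne' (signedArea_left _ _)
      refine ⟨(z.2 - p.2) / (q.2 - p.2), Prod.ext ?_ ?_⟩
      · have : z.1 - p.1 = 0 := by simpa [h1, h2] using hi
        simp only [lerp]
        rw [show q.1 = p.1 by linarith]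
        linarith
      · simp only [lerp]; field_simp; ring
    · refine ⟨(z.1 - p.1) / (q.1 - p.1), Prod.ext ?_ ?_⟩
      · simp only [lerp]; field_simp; ring
      · simp only [lerp]; field_simp; linarith
  obtain ⟨t, rfl⟩ := hpq
  refine ⟨t, ⟨?_, ?_⟩, rfl⟩
  · have h := hz (i - 1)
    have h0 : F.height (i - 1) p = 0 := by
      rw [height, sub_add_cancel]
      exact signedArea_right _ _
    rw [height_lerp, h0, mul_zero, zero_add] at h
    exact nonneg_of_mul_nonneg_left h hprev
  · have h := hz (i + 1)
    have h0 : F.height (i + 1) q = 0 := signedArea_left _ _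
    rw [height_lerp, h0, mul_zero, add_zero] at h
    exact sub_nonneg.1 (nonneg_of_mul_nonneg_left h hnext)

theorem onSide_mem_closedPolygon (i : Fin n) {t : ℝ} (ht : t ∈ Icc (0 : ℝ) 1) :
    F.onSide i t ∈ F.closedPolygon := fun _ => F.height_onSide_nonneg _ _ ht

theorem continuous_height (i : Fin n) : Continuous (F.height i) := by
  unfold height signedArea; fun_prop

theorem isOpen_interior : IsOpen F.interior := by
  simp only [interior, ofPred_forall]
  exact isOpen_iInter_of_finite fun i => isOpen_lt continuous_const (F.continuous_height i)

theorem isCompact_closedPolygon : IsCompact F.closedPolygon := by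
  have hc : IsClosed F.closedPolygon := by
    simp only [closedPolygon, ofPred_forall]
    exact isClosed_iInter fun i => isClosed_le continuous_const (F.continuous_height i)
  refine (isCompact_Icc.prod isCompact_Icc).of_isClosed_subset hc
    (t := F.closedPolygon) (s := Icc (-4 : ℝ) 12 ×ˢ Icc (-4 : ℝ) 12) fun z hz => F.mem_box hz

theorem closedPolygon_subset_closure : F.closedPolygon ⊆ closure F.interior := by
  intro z hz
  obtain ⟨c, hc⟩ := F.interior_nonempty
  have hcont : Continuous fun t : ℝ => lerp z c t := by fun_prop
  have h0 : (0 : ℝ) ∈ closure (Ioo (0 : ℝ) 1) := by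
    rw [closure_Ioo (by norm_num)]
    simp
  have := map_mem_closure hcont h0 (t := F.interior) fun t ht i => by
    rw [height_lerp]
    exact convexComb_pos ht (hz i) (hc i).le (add_pos_of_nonneg_of_pos (hz i) (hc i))
  simpa using this

theorem isPreconnected_interior : IsPreconnected F.interior := by
  refine Convex.isPreconnected fun z hz w hw a b ha hb hab => ?_
  rcases hb.eq_or_lt with rfl | hb
  · rw [add_zero] at hab
    simpa [hab] using hz
  rcases ha.eq_or_lt with rfl | ha
  · rw [zero_add] at hab
    simpa [hab] using hw
  intro i
  have h : a • z + b • w = lerp z w b := by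
    ext <;> simp [lerp, ← hab]
  rw [h, height_lerp]
  exact convexComb_pos ⟨hb, by linarith⟩ (hz i).le (hw i).le (add_pos (hz i) (hw i))

/-- The closed polygon is compact, so its image is closed; every point of it is a limit of interior
points along a segment to a fixed interior point. -/
theorem closure_gridTorus_image :
    closure (gridTorus '' F.interior) = gridTorus '' F.closedPolygon := by
  apply subset_antisymm
  · exact closure_minimal (image_mono F.interior_subset)
      (F.isCompact_closedPolygon.image continuous_gridTorus).isClosed
  · exact (image_mono F.closedPolygon_subset_closure).trans
      (image_closure_subset_closure_image continuous_gridTorus)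

theorem frontier_gridTorus_image :
    frontier (gridTorus '' F.interior) = ⋃ i, range (D.arc (F.side i)) := by
  rw [(isOpenMap_gridTorus _ F.isOpen_interior).frontier_eq, closure_gridTorus_image]
  apply subset_antisymm
  · rintro _ ⟨⟨z, hz, rfl⟩, hn⟩
    obtain ⟨i, hi⟩ : ∃ i, F.height i z ≤ 0 := by
      by_contra! h
      exact hn ⟨z, h, rfl⟩
    rw [mem_iUnion]
    refine ⟨i, ?_⟩
    rw [range_arc_side]
    exact mem_image_of_mem _ (F.mem_onSide hz (hi.antisymm (hz i)))
  · refine iUnion_subset fun i z hz => ⟨?_, ?_⟩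
    · rw [range_arc_side] at hz
      obtain ⟨_, ⟨t, ht, rfl⟩, rfl⟩ := hz
      exact mem_image_of_mem _ (F.onSide_mem_closedPolygon i ht)
    · rintro ⟨w, hw, rfl⟩
      exact F.gridTorus_notMem_image hw (mem_iUnion.2 ⟨_, hz⟩)

/-- The image of the open polygon is connected and open, and its frontier lies in the drawing. It is
therefore relatively clopen in the complement of the drawing. -/
theorem connectedComponentIn_compl_image {z : ℝ × ℝ} (hz : z ∈ F.interior) :
    connectedComponentIn D.imageᶜ (gridTorus z) = gridTorus '' F.interior := by
  have hsub : gridTorus '' F.interior ⊆ D.imageᶜ := by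
    rintro _ ⟨w, hw, rfl⟩
    exact F.gridTorus_notMem_image hw
  have hz' := mem_image_of_mem gridTorus hz
  apply subset_antisymm
  · refine isPreconnected_connectedComponentIn.subset_of_closure_inter_subset
      (isOpenMap_gridTorus _ F.isOpen_interior)
      ⟨_, mem_connectedComponentIn (hsub hz'), hz'⟩ ?_
    rintro w ⟨hw, hwc⟩
    by_contra hn
    have hf : w ∈ frontier (gridTorus '' F.interior) := by
      rw [(isOpenMap_gridTorus _ F.isOpen_interior).frontier_eq]
      exact ⟨hw, hn⟩
    rw [frontier_gridTorus_image] at hf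
    obtain ⟨i, hi⟩ := mem_iUnion.1 hf
    exact connectedComponentIn_subset _ _ hwc (mem_iUnion.2 ⟨_, hi⟩)
  · exact (F.isPreconnected_interior.image _ continuous_gridTorus.continuousOn)
      |>.subset_connectedComponentIn hz' hsub

/-- Injectivity on the open polygon says nothing about its boundary; on a side it comes from the arc
of the drawing instead. -/
theorem gridTorus_onSide_injOn (i : Fin n) :
    InjOn (fun t => gridTorus (F.onSide i t)) (Ioo (0 : ℝ) 1) := by
  intro s hs t ht h
  lift s to unitInterval using Ioo_subset_Icc_self hs
  lift t to unitInterval using Ioo_subset_Icc_self ht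
  have inj := D.arc_injOn (F.side i)
  rcases F.side_image i with h' | h'
  · simp only [h'] at h
    exact congrArg _ (inj hs ht h)
  · simp only [h'] at h
    have hm : ∀ r : unitInterval, (r : ℝ) ∈ Ioo (0 : ℝ) 1 → unitInterval.symm r ∈ Ioo 0 1 := by
      intro r hr
      refine ⟨unitInterval.pos_iff_ne_zero.2 ?_, unitInterval.lt_one_iff_ne_one.2 ?_⟩
      · simpa using (show r < 1 from hr.2).ne
      · simpa using (show 0 < r from hr.1).ne'
    exact congrArg _ (unitInterval.symm_inj.1 (inj (hm s hs) (hm t ht) h))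

/-! ### Chords and lollipops inside a face -/

section embedding

variable {α β : Type*} {G : Graph α β} {φ : G.SpaceEmbedding (UnitAddTorus (Fin 2))}
  (hφ : φ.image = D.image)

include hφ

theorem isFace : φ.IsFace (gridTorus '' F.interior) := by
  obtain ⟨z, hz⟩ := F.interior_nonempty
  exact ⟨gridTorus z, hφ ▸ F.gridTorus_notMem_image hz,
    by rw [hφ, F.connectedComponentIn_compl_image hz]⟩

/-- A curve in the open polygon gives a curve in a face. -/
theorem gridTorus_comp (γ : C(unitInterval, ℝ × ℝ)) (hi : InjOn γ (Ioo 0 1))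
    (hγ : MapsTo γ (Ioo 0 1) F.interior) :
    InjOn ((⟨gridTorus, continuous_gridTorus⟩ : C(ℝ × ℝ, _)).comp γ) (Ioo 0 1) ∧
      ((⟨gridTorus, continuous_gridTorus⟩ : C(ℝ × ℝ, _)).comp γ) '' Ioo 0 1 ⊆ φ.imageᶜ := by
  refine ⟨F.gridTorus_injOn.comp hi hγ, ?_⟩
  rintro _ ⟨t, ht, rfl⟩
  rw [hφ]
  exact F.gridTorus_notMem_image (hγ ht)

theorem hasChord {i j : Fin n} (hij : i ≠ j) {e f : β} (hef : e ≠ f) (he : e ∈ G.edgeSet)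
    (hf : f ∈ G.edgeSet) (hei : φ.arc e = D.arc (F.side i)) (hfj : φ.arc f = D.arc (F.side j)) :
    φ.HasChord e f := by
  have half : (1 / 2 : ℝ) ∈ Ioo (0 : ℝ) 1 := by constructor <;> norm_num
  have hp := F.onSide_mem_arc_image i half
  have hq := F.onSide_mem_arc_image j half
  rw [← hei] at hp
  rw [← hfj] at hq
  let γ : C(unitInterval, ℝ × ℝ) :=
    ⟨fun t => lerp (F.onSide i (1 / 2)) (F.onSide j (1 / 2)) t, by fun_prop⟩
  have γi : InjOn γ (Ioo 0 1) := by
    intro s _ t _ h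
    -- Along the segment between the midpoints, the height over side `i` grows linearly from zero,
    -- so it determines the parameter.
    have h1 := congrArg (F.height i) h
    change F.height i (lerp _ _ _) = F.height i (lerp _ _ _) at h1
    rw [height_lerp, height_lerp, height_onSide_self, mul_zero, mul_zero, zero_add, zero_add] at h1
    exact Subtype.ext (mul_right_cancel₀ (F.height_onSide_pos hij half).ne' h1)
  obtain ⟨h1, h2⟩ := F.gridTorus_comp hφ γ γi fun t ht =>
    F.lerp_onSide_mem_interior hij half half ht
  exact ⟨_, hp, _, hq, fun h => disjoint_left.1 (φ.disjoint_image_Ioo he hf hef) hp (h ▸ hq),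
    _, by simp [γ], by simp [γ], h1, h2⟩

theorem hasChord_self (i : Fin n) {e : β}
    (hei : φ.arc e = D.arc (F.side i)) : φ.HasChord e e := by
  obtain ⟨c, hc⟩ := F.interior_nonempty
  have third : (1 / 3 : ℝ) ∈ Ioo (0 : ℝ) 1 := by constructor <;> norm_num
  have twoThirds : (2 / 3 : ℝ) ∈ Ioo (0 : ℝ) 1 := by constructor <;> norm_num
  have hp := F.onSide_mem_arc_image i third
  have hq := F.onSide_mem_arc_image i twoThirds
  have hpq : gridTorus (F.onSide i (1 / 3)) ≠ gridTorus (F.onSide i (2 / 3)) := fun h => by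
    have := F.gridTorus_onSide_injOn i third twoThirds h
    norm_num at this
  rw [← hei] at hp hq
  -- A straight segment would run along the side itself, so the curve bulges towards `c`; the first
  -- fan coordinate is affine in `t` and gives injectivity.
  let γ : C(unitInterval, ℝ × ℝ) :=
    ⟨fun t => F.fan c i ((1 + t) / 3) (t * (1 - t)), by unfold fan onSide; fun_prop⟩
  have hs : ∀ t : unitInterval, t ∈ Ioo 0 1 → (t * (1 - t) : ℝ) ∈ Ioo (0 : ℝ) 1 := by
    intro t ht
    have h0 : (0 : ℝ) < t := ht.1
    have h1 : (t : ℝ) < 1 := ht.2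
    constructor <;> nlinarith
  have γi : InjOn γ (Ioo 0 1) := by
    intro s hs' t _ h
    have := (F.fan_injective hc (hs s hs').2 h).1
    exact Subtype.ext (by linarith)
  have γm : MapsTo γ (Ioo 0 1) F.interior := by
    intro t ht
    have h0 : (0 : ℝ) < t := ht.1
    have h1 : (t : ℝ) < 1 := ht.2
    exact F.fan_mem_interior hc i (by constructor <;> linarith) (hs t ht)
  obtain ⟨h1, h2⟩ := F.gridTorus_comp hφ γ γi γm
  exact ⟨_, hp, _, hq, hpq, _, by simp [γ, fan], by norm_num [γ, fan], h1, h2⟩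

theorem hasLollipop (i : Fin n) {e : β} (hei : φ.arc e = D.arc (F.side i)) :
    φ.HasLollipop e := by
  obtain ⟨c, hc⟩ := F.interior_nonempty
  have half : (1 / 2 : ℝ) ∈ Ioo (0 : ℝ) 1 := by constructor <;> norm_num
  have hp := F.onSide_mem_arc_image i half
  rw [← hei] at hp
  have hq := F.fan_mem_interior hc i (Ioo_subset_Icc_self half) half
  let γ : C(unitInterval, ℝ × ℝ) :=
    ⟨fun t => F.fan c i (1 / 2) (t / 2), by unfold fan; fun_prop⟩
  -- With `x = t(1 - t)`, the loop has fan coordinates `(1/2 + x(2t - 1), 1/2 + x/4)`. The second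
  -- one determines `x`, and then the first determines `t`, so the loop is simple. It stays at `s >
  -- 1/2`, while the stem `γ` stays at `s < 1/2`.
  let l : C(unitInterval, ℝ × ℝ) :=
    ⟨fun t => F.fan c i (1 / 2 + t * (1 - t) * (2 * t - 1)) (1 / 2 + t * (1 - t) / 4), by
      unfold fan onSide; fun_prop⟩
  have hx : ∀ t : unitInterval, t ∈ Ioo 0 1 →
      (0 : ℝ) < t * (1 - t) ∧ (t * (1 - t) : ℝ) ≤ 1 / 4 ∧ (t : ℝ) < 1 ∧ (0 : ℝ) < t := by
    intro t ht
    have h0 : (0 : ℝ) < t := ht.1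
    have h1 : (t : ℝ) < 1 := ht.2
    refine ⟨?_, ?_, h1, h0⟩ <;> nlinarith [sq_nonneg ((t : ℝ) - 1 / 2)]
  have γm : MapsTo γ (Ioo 0 1) F.interior := by
    intro t ht
    obtain ⟨-, -, h1, h0⟩ := hx t ht
    exact F.fan_mem_interior hc i (Ioo_subset_Icc_self half) (by constructor <;> linarith)
  have lm : MapsTo l (Ioo 0 1) F.interior := by
    intro t ht
    obtain ⟨hx0, hx1, h1, h0⟩ := hx t ht
    refine F.fan_mem_interior hc i ?_ (by constructor <;> linarith)
    constructor <;> nlinarith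
  have γl : ∀ s ∈ Ioo (0 : unitInterval) 1, ∀ t ∈ Ioo (0 : unitInterval) 1, γ s ≠ l t := by
    intro s hs t ht h
    obtain ⟨-, -, h1, h0⟩ := hx s hs
    have := (F.fan_injective hc (by linarith) h).2
    linarith [(hx t ht).1]
  have γi : InjOn γ (Ioo 0 1) := by
    intro s hs t ht h
    have := (F.fan_injective hc (by linarith [(hx s hs).2.2.1]) h).2
    exact Subtype.ext (by linarith)
  have li : InjOn l (Ioo 0 1) := by
    intro s hs t ht h
    obtain ⟨h1, h2⟩ := F.fan_injective hc (by linarith [(hx s hs).2.1]) h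
    have h2 : (s * (1 - s) : ℝ) = t * (1 - t) := by linarith
    rw [← h2] at h1
    have := mul_left_cancel₀ (hx s hs).1.ne' (add_left_cancel h1)
    exact Subtype.ext (by linarith)
  obtain ⟨h1, h2⟩ := F.gridTorus_comp hφ γ γi γm
  obtain ⟨h3, h4⟩ := F.gridTorus_comp hφ l li lm
  refine ⟨_, hp, _, hφ ▸ F.gridTorus_notMem_image hq, _, _, by simp [γ, fan], by simp [γ],
    by simp [l], by simp [l], h1, h3, h2, h4, ?_, ?_, ?_⟩
  · rintro ⟨t, ht, h⟩
    have h := F.gridTorus_injOn (γm ht) hq h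
    obtain ⟨-, -, h1, h0⟩ := hx t ht
    have := (F.fan_injective hc (by linarith) h).2
    linarith
  · rintro ⟨t, ht, h⟩
    have h := F.gridTorus_injOn (lm ht) hq h
    have := (F.fan_injective hc (by linarith [(hx t ht).2.1]) h).2
    linarith [(hx t ht).1]
  · rw [disjoint_left]
    rintro _ ⟨s, hs, rfl⟩ ⟨t, ht, h⟩
    exact γl s hs t ht (F.gridTorus_injOn (lm ht) (γm hs) h).symm

end embedding

end TorusDrawing.Face

/-! ### Short cycles created by an added edge -/

namespace Graph

variable {α β X : Type*}

theorem IsCycleOn.girth_le {G : Graph α β} {n : ℕ} {v : ZMod n → α} {e : ZMod n → β}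
    (h : G.IsCycleOn n v e) : G.girth ≤ n :=
  sInf_le ⟨n, v, e, h, rfl⟩

theorem girth_addEdge_lollipop_le {G : Graph α β} {e : β} {x y : α} (h : G.IsLink e x y) :
    (G.addEdge (.lollipop e x y h)).girth ≤ 1 := by
  refine (IsCycleOn.girth_le (n := 1) (v := fun _ => .inr 1) (e := fun _ => .inr 3)
    ⟨one_pos, ?_, ?_, fun _ => rfl⟩).trans (by simp)
  · exact fun i j _ => Subsingleton.elim i j
  · exact fun i j _ => Subsingleton.elim i j

theorem girth_addEdge_parallel_le {G : Graph α β} {e : β} {x y : α} (h : G.IsLink e x y) :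
    (G.addEdge (.parallel e x y h)).girth ≤ 2 := by
  -- Positions 1 and 3 of `newEnds` hold the two parallel edges between `u` and `v`.
  refine (IsCycleOn.girth_le (n := 2) (v := (![.inr 0, .inr 1] : Fin 2 → _))
    (e := (![.inr 1, .inr 3] : Fin 2 → _)) ⟨two_pos, ?_, ?_, ?_⟩).trans (by simp)
  · intro i j hij
    fin_cases i <;> fin_cases j <;> first | rfl | simp at hij
  · intro i j hij
    fin_cases i <;> fin_cases j <;> first | rfl | simp at hij
  · intro i
    fin_cases i
    · rfl
    · exact congrArg some Sym2.eq_swap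

/-- Joining two edges with a common end creates a triangle. -/
theorem girth_addEdge_join_le {G : Graph α β} {e₁ e₂ : β} {x₁ y₁ x₂ y₂ : α}
    (h₁ : G.IsLink e₁ x₁ y₁) (h₂ : G.IsLink e₂ x₂ y₂) (hne : e₁ ≠ e₂) {w : α}
    (hw₁ : w = x₁ ∨ w = y₁) (hw₂ : w = x₂ ∨ w = y₂) :
    (G.addEdge (.join e₁ x₁ y₁ h₁ e₂ x₂ y₂ h₂ hne)).girth ≤ 3 := by
  set c : G.EdgeAddition := .join e₁ x₁ y₁ h₁ e₂ x₂ y₂ h₂ hne with hc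
  -- The bounds `i < 2` and `2 ≤ j < 4` serve to show that the edges at positions `i`, `j` and 4 are
  -- distinct.
  obtain ⟨i, hi, hi'⟩ : ∃ i < 2, c.newEnds[i]? = some s(.inl w, .inr 0) := by
    rcases hw₁ with rfl | rfl
    · exact ⟨0, by norm_num, rfl⟩
    · exact ⟨1, by norm_num, congrArg some Sym2.eq_swap⟩
  obtain ⟨j, hj, hj', hj''⟩ : ∃ j, 2 ≤ j ∧ j < 4 ∧ c.newEnds[j]? = some s(.inr 1, .inl w) := by
    rcases hw₂ with rfl | rfl
    · exact ⟨2, by norm_num, by norm_num, congrArg some Sym2.eq_swap⟩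
    · exact ⟨3, by norm_num, by norm_num, rfl⟩
  refine (IsCycleOn.girth_le (n := 3) (v := (![.inl w, .inr 0, .inr 1] : Fin 3 → _))
    (e := (![.inr i, .inr 4, .inr j] : Fin 3 → _)) ⟨three_pos, ?_, ?_, ?_⟩).trans (by simp)
  · intro k l hkl
    fin_cases k <;> fin_cases l <;> first | rfl | simp at hkl
  · intro k l hkl
    fin_cases k <;> fin_cases l <;> first | rfl | (simp at hkl; omega)
  · intro k
    fin_cases k
    exacts [hi', rfl, hj'']

/-! ### Transport of embeddings along automorphisms -/

namespace SpaceEmbedding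

variable [TopologicalSpace X] {H : SimpleGraph α}

theorem map_mem_edgeSet (τ : H ≃g H) {e : Sym2 α} (he : e ∈ H.edgeSet) :
    e.map τ ∈ H.edgeSet :=
  (SimpleGraph.Iso.map_mem_edgeSet_iff τ).2 he

/-- The embedding obtained by relabelling the vertices. -/
def relabel (φ : (ofSimpleGraph H).SpaceEmbedding X) (τ : H ≃g H) :
    (ofSimpleGraph H).SpaceEmbedding X where
  vert x := φ.vert (τ x)
  arc e := φ.arc (e.map τ)
  vert_injOn _ _ _ _ h := τ.injective (φ.vert_injOn trivial trivial h)
  arc_ends e he := by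
    induction e with | h a b => ?_
    obtain ⟨x, y, h, h0, h1⟩ := φ.arc_ends _ (map_mem_edgeSet τ he)
    refine ⟨τ.symm x, τ.symm y, ⟨?_, he⟩, by simpa using h0, by simpa using h1⟩
    have := congrArg (Sym2.map τ.symm) h.1
    simpa using this
  arc_injOn e he := φ.arc_injOn _ (map_mem_edgeSet τ he)
  arc_ne_vert e he t ht _ _ := φ.arc_ne_vert _ (map_mem_edgeSet τ he) t ht _ trivial
  arc_disjoint e he f hf hne := φ.arc_disjoint _ (map_mem_edgeSet τ he) _ (map_mem_edgeSet τ hf)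
    fun h => hne (Sym2.map.injective τ.injective h)

theorem compl_image_subset_relabel (φ : (ofSimpleGraph H).SpaceEmbedding X) (τ : H ≃g H) :
    φ.imageᶜ ⊆ (φ.relabel τ).imageᶜ := by
  refine compl_subset_compl.2 (union_subset ?_ (iUnion₂_subset fun e he => ?_))
  · rintro _ ⟨x, -, rfl⟩
    exact φ.vert_mem_image trivial
  · exact fun z hz => .inr (mem_biUnion (x := e.map τ) (map_mem_edgeSet τ he) hz)

theorem HasChord.relabel {φ : (ofSimpleGraph H).SpaceEmbedding X} {τ : H ≃g H} {e f : Sym2 α}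
    (h : φ.HasChord (e.map τ) (f.map τ)) : (φ.relabel τ).HasChord e f := by
  obtain ⟨p, hp, q, hq, hpq, γ, h0, h1, hi, hγ⟩ := h
  exact ⟨p, hp, q, hq, hpq, γ, h0, h1, hi, hγ.trans (φ.compl_image_subset_relabel τ)⟩

theorem HasLollipop.relabel {φ : (ofSimpleGraph H).SpaceEmbedding X} {τ : H ≃g H} {e : Sym2 α}
    (h : φ.HasLollipop (e.map τ)) : (φ.relabel τ).HasLollipop e := by
  obtain ⟨p, hp, q, hq, γ, l, h0, h1, l0, l1, hi, li, hγ, hl, h'⟩ := h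
  have hs := φ.compl_image_subset_relabel τ
  exact ⟨p, hp, q, hs hq, γ, l, h0, h1, l0, l1, hi, li, hγ.trans hs, hl.trans hs, h'⟩

end SpaceEmbedding

end Graph

/-! ### The drawing of `F₁₄`, its three faces and its automorphisms -/

namespace F14

open F14Vertex

instance : Fintype F14Vertex where
  elems := {A, Ap, B, Bp, n1, n2, n3, n4, n5, n6, n7, n8}
  complete x := by cases x <;> decide

/-- The ends of the edges of `F₁₄`. -/
def ends : Fin 18 → F14Vertex × F14Vertex :=
  ![(A, Ap), (B, Bp), (A, n1), (A, n5), (Ap, n3), (Ap, n7), (B, n2), (B, n6), (Bp, n4), (Bp, n8),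
    (n1, n2), (n2, n3), (n3, n4), (n4, n5), (n5, n6), (n6, n7), (n7, n8), (n8, n1)]

/-- The edges of `F₁₄`. -/
def edge (k : Fin 18) : Sym2 F14Vertex := s((ends k).1, (ends k).2)

theorem edge_injective : Function.Injective edge := by decide +kernel

theorem mem_edgeSet {e : Sym2 F14Vertex} : e ∈ F14.edgeSet ↔ ∃ k, edge k = e := by
  have hdiag : ∀ k, ¬ (edge k).IsDiag := by decide +kernel
  have hrange : e ∈ range edge ↔ e ∈ ({s(A, Ap), s(B, Bp),
      s(A, n1), s(A, n5), s(Ap, n3), s(Ap, n7), s(B, n2), s(B, n6), s(Bp, n4), s(Bp, n8),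
      s(n1, n2), s(n2, n3), s(n3, n4), s(n4, n5), s(n5, n6), s(n6, n7), s(n7, n8), s(n8, n1)} :
        Set (Sym2 F14Vertex)) := by
    simp [edge, ends, Fin.exists_fin_succ, eq_comm]
  rw [F14, SimpleGraph.edgeSet_fromEdgeSet, mem_sdiff, ← hrange]
  constructor
  · rintro ⟨⟨k, hk⟩, -⟩
    exact ⟨k, hk⟩
  · rintro ⟨k, rfl⟩
    exact ⟨⟨k, rfl⟩, hdiag k⟩

theorem adj_iff {x y : F14Vertex} : F14.Adj x y ↔ ∃ k, edge k = s(x, y) := by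
  rw [← SimpleGraph.mem_edgeSet, mem_edgeSet]

instance : DecidableRel F14.Adj := fun _ _ => decidable_of_iff _ adj_iff.symm

/-- The lattice points at which the vertices are drawn. -/
def position : F14Vertex → ℤ × ℤ
  | A => (1, 1) | Ap => (3, 6) | B => (4, 3) | Bp => (5, 0)
  | n1 => (6, 5) | n2 => (5, 5) | n3 => (4, 6) | n4 => (4, 0)
  | n5 => (3, 1) | n6 => (2, 4) | n7 => (1, 5) | n8 => (6, 7)

/-- The lift of the edge `k` ends in the translate by `winding k` of the position of its second
end. -/
def winding : Fin 18 → ℤ × ℤ :=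
  ![(0, -1), 0, (-1, 0), 0, 0, 0, 0, 0, 0, (0, -1), 0, 0, (0, 1), 0, 0, 0, (-1, 0), 0]

/-- A drawing of `F₁₄` on the torus. -/
def drawing : TorusDrawing (Fin 18) where
  tail k := position (ends k).1
  head k := gridTranslate (winding k).1 (winding k).2 (position (ends k).2)
  inBox := by decide +kernel
  ne := by decide +kernel
  short := by decide +kernel
  apart := by decide +kernel

/-- This allows a vertex to be treated as an end of an arc other than `k`, so that `arc_ne_arc` also
separates vertices from the interior of arc `k`. -/
theorem exists_ne_edge_of_vertex :
    ∀ x k, ∃ l, l ≠ k ∧ (x = (ends l).1 ∨ x = (ends l).2) := by decide +kernel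

theorem arc_zero (k : Fin 18) :
    drawing.arc k 0 = gridTorus (latticePoint (position (ends k).1)) := by
  simp [TorusDrawing.arc, TorusDrawing.lift, drawing]

theorem arc_one (k : Fin 18) :
    drawing.arc k 1 = gridTorus (latticePoint (position (ends k).2)) := by
  refine gridTorus_eq_iff.2 ⟨(winding k).1, (winding k).2, ?_⟩
  simp [TorusDrawing.lift, drawing, latticePoint, gridTranslate]

theorem exists_arc_eq_position (x : F14Vertex) (k : Fin 18) :
    ∃ l ≠ k, ∃ t, drawing.arc l t = gridTorus (latticePoint (position x)) := by
  obtain ⟨l, hl, rfl | rfl⟩ := exists_ne_edge_of_vertex x k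
  · exact ⟨l, hl, 0, arc_zero l⟩
  · exact ⟨l, hl, 1, arc_one l⟩

theorem invFun_edge (k : Fin 18) : Function.invFun edge (edge k) = k :=
  Function.leftInverse_invFun edge_injective k

theorem position_injective_mod : ∀ x y, (8 : ℤ) ∣ (position x).1 - (position y).1 →
    (8 : ℤ) ∣ (position x).2 - (position y).2 → x = y := by
  decide +kernel

/-- The embedding of `F₁₄` into the torus that is given by the drawing. -/
noncomputable def embedding : F14Graph.SpaceEmbedding (UnitAddTorus (Fin 2)) where
  vert x := gridTorus (latticePoint (position x))
  arc e := drawing.arc (Function.invFun edge e)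
  vert_injOn x _ y _ h := by
    obtain ⟨m, n, hm, hn⟩ := gridTorus_eq_iff.1 h
    simp only [latticePoint] at hm hn
    refine position_injective_mod x y ⟨m, ?_⟩ ⟨n, ?_⟩
    · rw [sub_eq_iff_eq_add']; exact_mod_cast hm
    · rw [sub_eq_iff_eq_add']; exact_mod_cast hn
  arc_ends e he := by
    obtain ⟨k, rfl⟩ := mem_edgeSet.1 he
    rw [invFun_edge]
    exact ⟨_, _, ⟨rfl, he⟩, arc_zero k, arc_one k⟩
  arc_injOn e _ := drawing.arc_injOn _
  arc_ne_vert e _ t ht x _ h := by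
    obtain ⟨l, hl, s, hs⟩ := exists_arc_eq_position x (Function.invFun edge e)
    exact drawing.arc_ne_arc hl.symm ht s (h.trans hs.symm)
  arc_disjoint e he f hf hne s hs t _ := by
    obtain ⟨k, rfl⟩ := mem_edgeSet.1 he
    obtain ⟨l, rfl⟩ := mem_edgeSet.1 hf
    rw [invFun_edge, invFun_edge]
    exact drawing.arc_ne_arc (fun h => hne (congrArg edge h)) hs t

theorem embedding_arc (k : Fin 18) : embedding.arc (edge k) = drawing.arc k :=
  congrArg drawing.arc (invFun_edge k)

theorem edge_mem (k : Fin 18) : edge k ∈ F14Graph.edgeSet := mem_edgeSet.2 ⟨k, rfl⟩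

theorem embedding_image : embedding.image = drawing.image := by
  apply subset_antisymm
  · refine union_subset ?_ (iUnion₂_subset fun e _ => subset_iUnion_of_subset _ subset_rfl)
    rintro _ ⟨x, -, rfl⟩
    obtain ⟨l, -, t, h⟩ := exists_arc_eq_position x 0
    exact mem_iUnion.2 ⟨l, t, h⟩
  · refine iUnion_subset fun k z hz => .inr (mem_biUnion (edge_mem k) ?_)
    rwa [embedding_arc]

/-- The face `A 1 2 B B' 8 7 A'`. -/
def octagon : drawing.Face 8 where
  corner := ![(1, 1), (-2, 5), (-3, 5), (-4, 3), (-3, 0), (-2, -1), (1, -3), (3, -2)]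
  side := ![2, 10, 6, 1, 9, 16, 5, 0]
  succ_ne := by decide +kernel
  convex := by decide +kernel
  strict := by decide +kernel
  side_eq := by decide +kernel
  box := by decide +kernel
  avoid := by decide +kernel
  avoid_self := by decide +kernel

/-- The face `A 5 6 7 8 1`. -/
def hexagonA : drawing.Face 6 where
  corner := ![(1, 1), (3, 1), (2, 4), (1, 5), (-2, 7), (-2, 5)]
  side := ![3, 14, 15, 16, 17, 2]
  succ_ne := by decide +kernel
  convex := by decide +kernel
  strict := by decide +kernel
  side_eq := by decide +kernel
  box := by decide +kernel
  avoid := by decide +kernel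
  avoid_self := by decide +kernel

/-- The face `A' 7 6 B 2 3`. -/
def hexagonB : drawing.Face 6 where
  corner := ![(3, 6), (1, 5), (2, 4), (4, 3), (5, 5), (4, 6)]
  side := ![5, 15, 7, 6, 11, 4]
  succ_ne := by decide +kernel
  convex := by decide +kernel
  strict := by decide +kernel
  side_eq := by decide +kernel
  box := by decide +kernel
  avoid := by decide +kernel
  avoid_self := by decide +kernel

theorem hasFacialCycle : embedding.HasFacialCycle 8 := by
  refine ⟨gridTorus '' octagon.interior, (![A, n1, n2, B, Bp, n8, n7, Ap] : Fin 8 → _),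
    fun i : Fin 8 => edge (octagon.side i), octagon.isFace embedding_image,
    ⟨by norm_num, ?_, ?_, ?_⟩, ?_⟩
  · change Function.Injective (![A, n1, n2, B, Bp, n8, n7, Ap] : Fin 8 → _)
    decide +kernel
  · refine edge_injective.comp ?_
    change Function.Injective octagon.side
    decide +kernel
  · have h : ∀ i : Fin 8, edge (octagon.side i) =
        s((![A, n1, n2, B, Bp, n8, n7, Ap] : Fin 8 → _) i,
          (![A, n1, n2, B, Bp, n8, n7, Ap] : Fin 8 → _) (i + 1)) := by decide +kernel
    exact fun i => ⟨h i, edge_mem _⟩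
  · rw [octagon.frontier_gridTorus_image]
    simp only [embedding_arc]
    rfl

/-- The automorphism that rotates the cycle `1 2 … 8`. -/
def rotation : F14 ≃g F14 where
  toFun
    | A => B | B => Ap | Ap => Bp | Bp => A | n1 => n2 | n2 => n3
    | n3 => n4 | n4 => n5 | n5 => n6 | n6 => n7 | n7 => n8 | n8 => n1
  invFun
    | B => A | Ap => B | Bp => Ap | A => Bp | n2 => n1 | n3 => n2
    | n4 => n3 | n5 => n4 | n6 => n5 | n7 => n6 | n8 => n7 | n1 => n8
  left_inv := by intro x; cases x <;> rfl
  right_inv := by intro x; cases x <;> rfl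
  map_rel_iff' := by decide +kernel

/-- The automorphism that reflects the cycle `1 2 … 8` and fixes `1` and `5`. -/
def reflection : F14 ≃g F14 where
  toFun
    | A => A | B => Bp | Ap => Ap | Bp => B | n1 => n1 | n2 => n8
    | n3 => n7 | n4 => n6 | n5 => n5 | n6 => n4 | n7 => n3 | n8 => n2
  invFun
    | A => A | B => Bp | Ap => Ap | Bp => B | n1 => n1 | n2 => n8
    | n3 => n7 | n4 => n6 | n5 => n5 | n6 => n4 | n7 => n3 | n8 => n2
  left_inv := by intro x; cases x <;> rfl
  right_inv := by intro x; cases x <;> rfl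
  map_rel_iff' := by decide +kernel

/-- The automorphisms of `F₁₄`. -/
def automorphism (a : Fin 8 × Fin 2) : F14 ≃g F14 := rotation ^ (a.1 : ℕ) * reflection ^ (a.2 : ℕ)

theorem exists_automorphism_mem_cases : ∀ k l, (∀ x ∈ edge k, x ∉ edge l) →
    ∃ p ∈ F14Cases, ∃ a, (edge k = p.1.map (automorphism a) ∧ edge l = p.2.map (automorphism a)) ∨
      (edge k = p.2.map (automorphism a) ∧ edge l = p.1.map (automorphism a)) := by
  decide +kernel

/-- Each of the three faces is needed. Only the octagon contains `AA'` and `BB'`. The automorphisms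
used preserve the distance of edges along the cycle `1 2 … 8`: pairs at distance 1 and 3 occur only
on `hexagonA`, and pairs at distance 4 only on `hexagonB`. -/
theorem exists_automorphism_sides : ∀ k l, k ≠ l → ∃ a,
    (∃ i, edge (octagon.side i) = (edge k).map (automorphism a) ∧
      ∃ j, i ≠ j ∧ edge (octagon.side j) = (edge l).map (automorphism a)) ∨
    (∃ i, edge (hexagonA.side i) = (edge k).map (automorphism a) ∧
      ∃ j, i ≠ j ∧ edge (hexagonA.side j) = (edge l).map (automorphism a)) ∨
    (∃ i, edge (hexagonB.side i) = (edge k).map (automorphism a) ∧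
      ∃ j, i ≠ j ∧ edge (hexagonB.side j) = (edge l).map (automorphism a)) := by
  decide +kernel

end F14

/-! ### Assembly of the three claims -/

namespace F14

/-- Up to automorphisms, any two edges lie on a common face. -/
theorem exists_hasChord {e f : Sym2 F14Vertex} (he : e ∈ F14.edgeSet) (hf : f ∈ F14.edgeSet)
    (hne : e ≠ f) : ∃ τ : F14 ≃g F14, embedding.HasChord (e.map τ) (f.map τ) ∧
      embedding.HasChord (e.map τ) (e.map τ) ∧ embedding.HasLollipop (e.map τ) := by
  obtain ⟨k, rfl⟩ := mem_edgeSet.1 he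
  obtain ⟨l, rfl⟩ := mem_edgeSet.1 hf
  obtain ⟨a, h⟩ := exists_automorphism_sides k l (fun h => hne (congrArg edge h))
  have key : ∀ {n : ℕ} [NeZero n] (F : drawing.Face n),
      (∃ i, edge (F.side i) = (edge k).map (automorphism a) ∧
        ∃ j, i ≠ j ∧ edge (F.side j) = (edge l).map (automorphism a)) →
      embedding.HasChord ((edge k).map (automorphism a)) ((edge l).map (automorphism a)) ∧
      embedding.HasChord ((edge k).map (automorphism a)) ((edge k).map (automorphism a)) ∧
      embedding.HasLollipop ((edge k).map (automorphism a)) := by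
    rintro n _ F ⟨i, hi, j, hij, hj⟩
    have hne' : edge (F.side i) ≠ edge (F.side j) := by
      rw [hi, hj]
      exact fun h => hne (Sym2.map.injective (automorphism a).injective h)
    rw [← hi, ← hj]
    exact ⟨F.hasChord embedding_image hij hne' (edge_mem _) (edge_mem _) (embedding_arc _)
      (embedding_arc _), F.hasChord_self embedding_image i (embedding_arc _),
      F.hasLollipop embedding_image i (embedding_arc _)⟩
  exact ⟨automorphism a, h.elim (key octagon) (Or.elim · (key hexagonA) (key hexagonB))⟩

/-- Lollipops and parallel edges involve one edge only; an arbitrary second edge makes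
`exists_hasChord` applicable to them. -/
theorem exists_edge_ne (e : Sym2 F14Vertex) : ∃ f ∈ F14.edgeSet, e ≠ f := by
  by_cases h : e = edge 0
  · exact ⟨edge 1, edge_mem 1, h ▸ edge_injective.ne (by decide)⟩
  · exact ⟨edge 0, edge_mem 0, h⟩

theorem addEdge_isToroidal (c : F14Graph.EdgeAddition) : (F14Graph.addEdge c).IsToroidal := by
  cases c with
  | lollipop e x y h =>
    obtain ⟨f, hf, hne⟩ := exists_edge_ne e
    obtain ⟨τ, -, -, hτ⟩ := exists_hasChord h.2 hf hne
    exact Graph.SpaceEmbedding.nonempty_lollipop hτ.relabel h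
  | parallel e x y h =>
    obtain ⟨f, hf, hne⟩ := exists_edge_ne e
    obtain ⟨τ, -, hτ, -⟩ := exists_hasChord h.2 hf hne
    exact Graph.SpaceEmbedding.nonempty_parallel hτ.relabel h
  | join e₁ x₁ y₁ h₁ e₂ x₂ y₂ h₂ hne =>
    obtain ⟨τ, hτ, -, -⟩ := exists_hasChord h₁.2 h₂.2 hne
    obtain ⟨ψ, -⟩ := Graph.SpaceEmbedding.exists_extends_join hτ.relabel h₁ h₂ hne
    exact ⟨ψ⟩

theorem joins_of_four_le_girth (c : F14Graph.EdgeAddition)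
    (hc : 4 ≤ (F14Graph.addEdge c).girth) :
    ∃ p ∈ F14Cases, ∃ σ : F14 ≃g F14, c.Joins (p.1.map σ) (p.2.map σ) := by
  cases c with
  | lollipop e x y h =>
    exact absurd (hc.trans (Graph.girth_addEdge_lollipop_le h)) (by decide)
  | parallel e x y h =>
    exact absurd (hc.trans (Graph.girth_addEdge_parallel_le h)) (by decide)
  | join e₁ x₁ y₁ h₁ e₂ x₂ y₂ h₂ hne =>
    have hdisj : ∀ x ∈ e₁, x ∉ e₂ := by
      intro w hw₁ hw₂
      rw [h₁.1, Sym2.mem_iff] at hw₁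
      rw [h₂.1, Sym2.mem_iff] at hw₂
      exact absurd (hc.trans (Graph.girth_addEdge_join_le h₁ h₂ hne hw₁ hw₂)) (by decide)
    obtain ⟨k, hk⟩ := mem_edgeSet.1 h₁.2
    obtain ⟨l, hl⟩ := mem_edgeSet.1 h₂.2
    obtain ⟨p, hp, a, h⟩ := exists_automorphism_mem_cases k l (hk.symm ▸ hl.symm ▸ hdisj)
    rw [hk, hl] at h
    exact ⟨p, hp, automorphism a, h⟩

theorem cases_mem_edgeSet {p : Sym2 F14Vertex × Sym2 F14Vertex} (hp : p ∈ F14Cases) :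
    p.1 ∈ F14.edgeSet ∧ p.2 ∈ F14.edgeSet ∧ p.1 ≠ p.2 := by
  have h : F14Cases.all fun p => (∃ k, edge k = p.1) ∧ (∃ l, edge l = p.2) ∧ p.1 ≠ p.2 := by
    decide +kernel
  simpa only [mem_edgeSet] using of_decide_eq_true (List.all_eq_true.1 h p hp)

theorem exists_extends_embedding {p : Sym2 F14Vertex × Sym2 F14Vertex} (hp : p ∈ F14Cases) :
    ∃ (σ : F14 ≃g F14) (c : F14Graph.EdgeAddition), c.Joins (p.1.map σ) (p.2.map σ) ∧
      ∃ ψ : (F14Graph.addEdge c).SpaceEmbedding (UnitAddTorus (Fin 2)), ψ.Extends embedding := by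
  obtain ⟨h₁, h₂, hne⟩ := cases_mem_edgeSet hp
  obtain ⟨τ, hτ, -, -⟩ := exists_hasChord h₁ h₂ hne
  have hne' : p.1.map τ ≠ p.2.map τ := fun h => hne (Sym2.map.injective τ.injective h)
  have m₁ : p.1.map τ ∈ F14Graph.edgeSet := Graph.SpaceEmbedding.map_mem_edgeSet τ h₁
  have m₂ : p.2.map τ ∈ F14Graph.edgeSet := Graph.SpaceEmbedding.map_mem_edgeSet τ h₂
  obtain ⟨x₁, y₁, l₁⟩ := F14Graph.edge_mem_iff_exists_isLink _ |>.1 m₁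
  obtain ⟨x₂, y₂, l₂⟩ := F14Graph.edge_mem_iff_exists_isLink _ |>.1 m₂
  -- The automorphism that brings the pair onto a common face serves as `σ` itself. It is applied to
  -- the edges and not to the embedding, so one embedding works for all cases.
  exact ⟨τ, .join _ x₁ y₁ l₁ _ x₂ y₂ l₂ hne', .inl ⟨rfl, rfl⟩,
    Graph.SpaceEmbedding.exists_extends_join hτ l₁ l₂ hne'⟩

end F14

theorem mainTheorem9 :
    (∀ c : F14Graph.EdgeAddition, (F14Graph.addEdge c).IsToroidal) ∧
    (∀ c : F14Graph.EdgeAddition, 4 ≤ (F14Graph.addEdge c).girth →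
      ∃ p ∈ F14Cases, ∃ σ : F14 ≃g F14, c.Joins (p.1.map σ) (p.2.map σ)) ∧
    (∃ φ : F14Graph.SpaceEmbedding (UnitAddTorus (Fin 2)), φ.HasFacialCycle 8 ∧
      ∀ p ∈ F14Cases, ∃ (σ : F14 ≃g F14) (c : F14Graph.EdgeAddition),
        c.Joins (p.1.map σ) (p.2.map σ) ∧
        ∃ ψ : (F14Graph.addEdge c).SpaceEmbedding (UnitAddTorus (Fin 2)), ψ.Extends φ) := by
  exact ⟨F14.addEdge_isToroidal, F14.joins_of_four_le_girth, F14.embedding, F14.hasFacialCycle,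
    fun _ hp => F14.exists_extends_embedding hp⟩
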